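/- **Setting.** Let $G=(V,E)$ be a finite graph with non-negative edge costs $c$ and a nonempty set $R\subseteq V$ of terminals; the other vertices are Steiner vertices. A Steiner tree is a subtree of $G$ containing $R$; its minimum cost is $\mathrm{OPT}_{\mathrm{St}}$ ($\infty$ if there is none). For a nonempty $K\subseteq R$, a full component spanning $K$ is a subtree of $G$ whose terminals are exactly $K$, all of whose leaves are terminals and all of whose internal nodes are Steiner vertices; $C_K$ is the minimum cost of such a tree ($\infty$ if there is none). Let $\mathcal K$ be the set of nonempty subsets of $R$ and $\rho(X)=\max(0,|X|-1)$. For a partition $\pi$ of $R$ let $r(\pi)$ be its number of parts and $\mathrm{rc}^\pi_K$ the number of parts that meet $K$, minus one. The hypergraphic relaxations are the following. * $(\mathcal P)$: minimize $\sum_K C_Kx_K$ over $x\in\mathbb R^{\mathcal K}_{\ge0}$ with $\sum_K x_K\mathrm{rc}^\pi_K\ge r(\pi)-1$ for all partitions $\pi$ of $R$. * $(\mathcal P')$: the same with the additional constraint $\sum_K x_K(|K|-1)=|R|-1$. * $(\mathcal S)$: minimize $\sum_K C_Kx_K$ over $x\in\mathbb R^{\mathcal K}_{\ge0}$ with $\sum_K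 x_K\rho(K)=\rho(R)$ and $\sum_K x_K\rho(K\cap S)\le\rho(S)$ for all $S\subseteq R$. * $(\mathcal D)$, with root $r\in R$: minimize $\sum_{K,\,i\in K}C_Kx_{K^i}$ over $x\ge0$ such that, for every nonempty $U\subseteq R\setminus\{r\}$, the sum of $x_{K^i}$ over all $K\in\mathcal K$, $i\in K$ with $K\cap U\ne\varnothing$ and $i\notin U$ is at least $1$. **The heuristic** (Reduced One-Pass Loss-Contracting Heuristic, parameter $\alpha$). Let $G$ be complete and let $c$ satisfy the triangle inequality. For a set $A$ of edges, $G/A$ is obtained by contracting $A$; a node of $G/A$ is a terminal iff it contains a terminal of $G$, and $\mathrm{mtst}(G/A)$ is a minimum spanning tree of the subgraph of $G/A$ induced by its terminals. Fix, for every $K\in\mathcal K$ with $C_K<\infty$, a minimum-cost full component spanning $K$ in which all Steiner vertices have degree at least $3$; it is also denoted by $K$, its edge set by $E(K)$ and its cost by $c(K)$. Let $\mathrm{loss}(K)\subseteq E(K)$ be a minimum-cost set of edges connecting every vertex of $K$ to a terminal of $K$ and connecting no two terminals; $\mathrm{loss}(K)$ also denotes its cost. For a contracted graph $G'$ with $T=\mathrm{mtst}(G')$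 let $\mathrm{gain}_T(K)=c(T)-c(\mathrm{mtst}(G'/E(K)))-c(K)$. Start with $G_1=G$, $T_1=\mathrm{mtst}(G)$, $i=1$ and examine the components $K$ once each, in any order. If $\mathrm{gain}_{T_i}(K)>(\alpha-1)\,\mathrm{loss}(K)$, put $K_i=K$, $G_{i+1}=G_i/\mathrm{loss}(K_i)$, $T_{i+1}=\mathrm{mtst}(G_{i+1})$ and increase $i$ by one. If $f$ is the final value of $i$, return $T_{alg}=T_f\cup\bigcup_{i<f}\mathrm{loss}(K_i)$. **Theorem.** 1. Let $G$ be complete and let $c$ satisfy the triangle inequality. Then the choices in the heuristic can be made, and with $\alpha=\sqrt3$, for all such choices and every order in which the components are examined, $T_{alg}$ contains the edge set of a Steiner tree, and $$c(T_{alg})\le\sqrt3\cdot\mathrm{OPT}(\mathcal P).$$ If no two of the contracted components $K_1,\dots,K_{f-1}$ share a Steiner vertex, then $T_{alg}$ itself is the edge set of a Steiner tree. 2. For every finite graph $G$ with non-negative edge costs and every nonempty set of terminals, $\mathrm{OPT}_{\mathrm{St}}$ is at most $\sqrt3$ times the optimal value of each of $(\mathcal P)$, $(\mathcal P')$, $(\mathcal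 S)$ and, for every root $r\in R$, $(\mathcal D)$; that is, the integrality gap of the hypergraphic relaxations is at most $\sqrt3$. -/

import Mathlib

open scoped NNReal ENNReal

namespace SteinerLP

noncomputable section

variable {V : Type*} [Fintype V] [DecidableEq V]

/-! ### Steiner tree instances

An instance is a finite graph `G` on `V`, edge costs `c : Sym2 V → ℝ≥0` (only the values on edges
of `G` matter) and a set of terminals `R : Finset V`. Vertices outside `R` are Steiner vertices. -/

/-- The total cost of a set of edges. -/
def cost (c : Sym2 V → ℝ≥0) (F : Finset (Sym2 V)) : ℝ≥0 := ∑ e ∈ F, c e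

/-- The edge set of a subgraph, as a `Finset`. -/
def edges {G : SimpleGraph V} (H : G.Subgraph) : Finset (Sym2 V) :=
  (Set.toFinite H.edgeSet).toFinset

/-- The graph is complete and the costs satisfy the triangle inequality. -/
def IsMetricInstance (G : SimpleGraph V) (c : Sym2 V → ℝ≥0) : Prop :=
  G = ⊤ ∧ ∀ u v w : V, u ≠ v → v ≠ w → u ≠ w → c s(u, w) ≤ c s(u, v) + c s(v, w)

/-- A Steiner tree: a subtree of `G` that contains all terminals. -/
def IsSteinerTree (G : SimpleGraph V) (R : Finset V) (S : G.Subgraph) : Prop :=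
  S.coe.IsTree ∧ (R : Set V) ⊆ S.verts

/-- The minimum cost of a Steiner tree (`⊤` if there is none). -/
def steinerOpt (G : SimpleGraph V) (c : Sym2 V → ℝ≥0) (R : Finset V) : ℝ≥0∞ :=
  ⨅ (S : G.Subgraph) (_ : IsSteinerTree G R S), (cost c (edges S) : ℝ≥0∞)

/-- `H` is a full component spanning the terminal set `K`: a subtree of `G` whose terminals are
exactly those in `K`, all of whose leaves are terminals and all of whose internal nodes are Steiner
vertices. (A leaf has at most one neighbour; a one-vertex tree is a leaf.) -/
def IsFullComponent (G : SimpleGraph V) (R K : Finset V) (H : G.Subgraph) : Prop :=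
  H.coe.IsTree ∧ H.verts ∩ (R : Set V) = (K : Set V) ∧
    ∀ v ∈ H.verts, v ∈ R ↔ (H.neighborSet v).Subsingleton

/-- The hyperedges: all nonempty sets of terminals. -/
def hyperedges (R : Finset V) : Finset (Finset V) := R.powerset.filter Finset.Nonempty

/-- `C_K`: the minimum cost of a full component spanning `K`, and `⊤` if there is none. -/
def hyperCost (G : SimpleGraph V) (c : Sym2 V → ℝ≥0) (R K : Finset V) : ℝ≥0∞ :=
  ⨅ (H : G.Subgraph) (_ : IsFullComponent G R K H), (cost c (edges H) : ℝ≥0∞)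

/-! ### The hypergraphic linear programming relaxations -/

/-- The objective `∑_K C_K x_K`. -/
def objective (G : SimpleGraph V) (c : Sym2 V → ℝ≥0) (R : Finset V) (x : Finset V → ℝ≥0) :
    ℝ≥0∞ :=
  ∑ K ∈ hyperedges R, (x K : ℝ≥0∞) * hyperCost G c R K

/-- The rank contribution `rc_K^π`: one less than the number of parts of `π` that `K` meets. -/
def rankContribution {R : Finset V} (π : Finpartition R) (K : Finset V) : ℝ :=
  ((π.parts.filter fun p => (K ∩ p).Nonempty).card : ℝ) - 1

/-- Feasibility for the (unbounded) partition LP `(P)`. -/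
def FeasibleP (R : Finset V) (x : Finset V → ℝ≥0) : Prop :=
  ∀ π : Finpartition R,
    (π.parts.card : ℝ) - 1 ≤ ∑ K ∈ hyperedges R, (x K : ℝ) * rankContribution π K

/-- The optimal value of the partition LP `(P)`. -/
def optP (G : SimpleGraph V) (c : Sym2 V → ℝ≥0) (R : Finset V) : ℝ≥0∞ :=
  ⨅ (x : Finset V → ℝ≥0) (_ : FeasibleP R x), objective G c R x

/-- Feasibility for the bounded partition LP `(P')`. -/
def FeasibleP' (R : Finset V) (x : Finset V → ℝ≥0) : Prop :=
  FeasibleP R x ∧ ∑ K ∈ hyperedges R, (x K : ℝ) * ((K.card : ℝ) - 1) = (R.card : ℝ) - 1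

/-- The optimal value of the bounded partition LP `(P')`. -/
def optP' (G : SimpleGraph V) (c : Sym2 V → ℝ≥0) (R : Finset V) : ℝ≥0∞ :=
  ⨅ (x : Finset V → ℝ≥0) (_ : FeasibleP' R x), objective G c R x

/-- `ρ(X) = max (0, |X| - 1)` (truncated subtraction is meant). -/
def rank (X : Finset V) : ℕ := X.card - 1

/-- Feasibility for the subtour elimination LP `(S)`. -/
def FeasibleS (R : Finset V) (x : Finset V → ℝ≥0) : Prop :=
  ∑ K ∈ hyperedges R, x K * (rank K : ℝ≥0) = (rank R : ℝ≥0) ∧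
    ∀ S ⊆ R, ∑ K ∈ hyperedges R, x K * (rank (K ∩ S) : ℝ≥0) ≤ (rank S : ℝ≥0)

/-- The optimal value of the subtour elimination LP `(S)`. -/
def optS (G : SimpleGraph V) (c : Sym2 V → ℝ≥0) (R : Finset V) : ℝ≥0∞ :=
  ⨅ (x : Finset V → ℝ≥0) (_ : FeasibleS R x), objective G c R x

/-- Feasibility for the directed hypergraph LP `(D)` with root `r`; `x K i` is the variable of the
hyperedge `K` directed towards its head `i ∈ K`. A set `U` of terminals is valid if it is nonempty
and does not contain `r`; the directed hyperedge leaves `U` if `K` meets `U` and `i ∉ U`. -/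
def FeasibleD (R : Finset V) (r : V) (x : Finset V → V → ℝ≥0) : Prop :=
  ∀ U ⊆ R, U.Nonempty → r ∉ U →
    1 ≤ ∑ K ∈ (hyperedges R).filter (fun K => (U ∩ K).Nonempty), ∑ i ∈ K \ U, x K i

/-- The optimal value of the directed hypergraph LP `(D)` with root `r`. -/
def optD (G : SimpleGraph V) (c : Sym2 V → ℝ≥0) (R : Finset V) (r : V) : ℝ≥0∞ :=
  ⨅ (x : Finset V → V → ℝ≥0) (_ : FeasibleD R r x),
    ∑ K ∈ hyperedges R, ∑ i ∈ K, (x K i : ℝ≥0∞) * hyperCost G c R K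

/-! ### Contraction and minimum terminal spanning trees

For a set `A` of edges, the nodes of the contracted graph `G / A` are the connected components of
`(V, A)`. Its edges are the edges of `G`, parallel edges being kept. -/

/-- The vertex `v` lies in a terminal node of `G / A`: its node contains a terminal. -/
def InTerminalNode (R : Finset V) (A : Finset (Sym2 V)) (v : V) : Prop :=
  ∃ r ∈ R, (SimpleGraph.fromEdgeSet (A : Set (Sym2 V))).Reachable v r

/-- The edge set `T` of the terminal-induced subgraph of `G / A` connects all terminal nodes. -/
def ConnectsTerminals (G : SimpleGraph V) (R : Finset V) (A T : Finset (Sym2 V)) : Prop :=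
  (∀ e ∈ T, e ∈ G.edgeSet ∧ ∀ v ∈ e, InTerminalNode R A v) ∧
    ∀ u ∈ R, ∀ v ∈ R, (SimpleGraph.fromEdgeSet ((A ∪ T : Finset (Sym2 V)) : Set (Sym2 V))).Reachable u v

/-- A terminal spanning tree of `G / A`: a spanning tree of its terminal-induced subgraph, that is,
an inclusion-minimal set of edges of this subgraph that connects its nodes. -/
def IsTST (G : SimpleGraph V) (R : Finset V) (A T : Finset (Sym2 V)) : Prop :=
  Minimal (ConnectsTerminals G R A) T

/-- A minimum terminal spanning tree of `G / A`. -/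
def IsMTST (G : SimpleGraph V) (c : Sym2 V → ℝ≥0) (R : Finset V) (A T : Finset (Sym2 V)) : Prop :=
  IsTST G R A T ∧ ∀ T', IsTST G R A T' → cost c T ≤ cost c T'

/-! ### The Reduced One-Pass Loss-Contracting Heuristic -/

/-- The edge set `L` of the full component `H` connects every vertex of `H` to a terminal of `H`. -/
def ConnectsToTerminals {G : SimpleGraph V} (R : Finset V) (H : G.Subgraph)
    (L : Finset (Sym2 V)) : Prop :=
  L ⊆ edges H ∧ ∀ v ∈ H.verts, ∃ r ∈ R, r ∈ H.verts ∧
    (SimpleGraph.fromEdgeSet (L : Set (Sym2 V))).Reachable v r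

/-- `L` is a loss of the full component `H`: a minimum-cost set of edges of `H` that connects every
vertex of `H` to a terminal of `H`. No two terminals are connected by `L`; this is automatic when
the costs are positive. -/
def IsLoss {G : SimpleGraph V} (c : Sym2 V → ℝ≥0) (R : Finset V) (H : G.Subgraph)
    (L : Finset (Sym2 V)) : Prop :=
  ConnectsToTerminals R H L ∧
    (∀ L', ConnectsToTerminals R H L' → cost c L ≤ cost c L') ∧
    ∀ r ∈ R, ∀ s ∈ R, (SimpleGraph.fromEdgeSet (L : Set (Sym2 V))).Reachable r s → r = s

/-- The hyperedges that are spanned by a full component. -/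
def IsSpannedHyperedge (G : SimpleGraph V) (R K : Finset V) : Prop :=
  K ∈ hyperedges R ∧ ∃ H : G.Subgraph, IsFullComponent G R K H

/-- The choices that the heuristic is free to make: for each hyperedge `K` a fixed minimum-cost full
component spanning `K` without Steiner vertices of degree two, a loss of this component, and a
minimum terminal spanning tree of each contracted graph `G / A`. -/
structure Choices (G : SimpleGraph V) (c : Sym2 V → ℝ≥0) (R : Finset V) where
  comp : Finset V → G.Subgraph
  comp_full : ∀ K, IsSpannedHyperedge G R K → IsFullComponent G R K (comp K)
  comp_min : ∀ K, IsSpannedHyperedge G R K →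
    ∀ H, IsFullComponent G R K H → cost c (edges (comp K)) ≤ cost c (edges H)
  comp_degree : ∀ K, IsSpannedHyperedge G R K →
    ∀ v ∈ (comp K).verts, v ∉ R → 3 ≤ ((comp K).neighborSet v).ncard
  loss : Finset V → Finset (Sym2 V)
  loss_spec : ∀ K, IsSpannedHyperedge G R K → IsLoss c R (comp K) (loss K)
  mtst : Finset (Sym2 V) → Finset (Sym2 V)
  mtst_spec : ∀ A, IsMTST G c R A (mtst A)

namespace Choices

variable {G : SimpleGraph V} {c : Sym2 V → ℝ≥0} {R : Finset V}

/-- `drop_T(K; c) = c(T) - mtst(G' / K; c)` for `G' = G / A` and `T = mtst(G'; c)`. -/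
def drop (𝒞 : Choices G c R) (A : Finset (Sym2 V)) (K : Finset V) : ℝ :=
  (cost c (𝒞.mtst A) : ℝ) - (cost c (𝒞.mtst (A ∪ edges (𝒞.comp K))) : ℝ)

/-- `gain_T(K; c) = drop_T(K; c) - c(K)` for `T = mtst(G / A; c)`. -/
def gain (𝒞 : Choices G c R) (A : Finset (Sym2 V)) (K : Finset V) : ℝ :=
  𝒞.drop A K - (cost c (edges (𝒞.comp K)) : ℝ)

/-- The list `K₁, …, K_{f-1}` of the full components whose loss is contracted when the heuristic
with parameter `α` examines the full components in the given list one after the other, starting from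
`G / A`. -/
def accepted (𝒞 : Choices G c R) (α : ℝ) :
    Finset (Sym2 V) → List (Finset V) → List (Finset V)
  | _, [] => []
  | A, K :: Ks =>
    if 𝒞.gain A K > (α - 1) * (cost c (𝒞.loss K) : ℝ) then
      K :: 𝒞.accepted α (A ∪ 𝒞.loss K) Ks
    else
      𝒞.accepted α A Ks

/-- All contracted edges `⋃ᵢ loss(Kᵢ)` of the run on `G`. -/
def contracted (𝒞 : Choices G c R) (α : ℝ) (order : List (Finset V)) : Finset (Sym2 V) :=
  (𝒞.accepted α ∅ order).toFinset.biUnion 𝒞.loss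

/-- The output `T_alg = T_f ∪ ⋃ᵢ loss(Kᵢ)`, where `T_f = mtst(G_f; c)` for the final contracted
graph `G_f`. -/
def output (𝒞 : Choices G c R) (α : ℝ) (order : List (Finset V)) : Finset (Sym2 V) :=
  𝒞.mtst (𝒞.contracted α order) ∪ 𝒞.contracted α order

end Choices

end

end SteinerLP

/-! Write every cost as a weighted sum over finitely many thresholds `t` of the indicators of `t < c
e`, with non-negative weights. By Kruskal's argument (`IsMTST.card_filter`), the number of edges
above `t` in mtst(G/A) is one less than the number of classes of `R` under the contracted edges and
the available edges of cost at most `t`. With `savings` of a terminal set `K` defined as the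
weighted sum of (classes of `K`) - 1, the cost of mtst(G/A) is the savings of `R`. The classes at
each threshold form a partition of `R`; summing the corresponding constraints of (P) gives
c(mtst(G/A)) ≤ ∑ x_K · savings_A(K) (`Resolves.cost_mtst_le_sum`). So it suffices to bound the
savings of single components, and savings can only decrease as more is contracted.

Let S = ∑ x_K c(K). On `G` itself, doubling and shortcutting a component gives savings ≤ 2 c(K)
(`savings_empty_le`), hence c(T_1) ≤ 2S. At the end of the run, savings ≤ c(K) + (α - 1) loss(K) for
every component: a rejected one failed the gain test, and an accepted one has its loss contracted,
which leaves at most c(K) - loss(K). Since all Steiner vertices have degree at least three, loss(K)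
≤ c(K)/2 (`IsLoss.two_mul_cost_le`), so c(T_f) ≤ (α + 1)/2 · S. Each acceptance lowers the tree cost
by at least α · loss(K), so α · (total loss) + c(T_f) ≤ c(T_1) ≤ 2S (`accepted_spec`). Together,
c(T_f) plus the total loss is at most (α² + 3)/(2α) · S, which is minimal at α = √3, with value √3 ·
S.

Arbitrary graphs reduce to their metric closure (`steinerOpt_le_optP`). Feasible solutions of the
other relaxations give feasible solutions of (P) of the same cost (`FeasibleS.feasibleP`,
`FeasibleD.feasibleP`). -/

namespace SteinerLP

/-! ### Connectivity by finite edge sets -/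

section Conn

variable {V : Type*}

/-- The vertices `u` and `v` are connected by edges of `E`. -/
def Conn (E : Finset (Sym2 V)) (u v : V) : Prop :=
  (SimpleGraph.fromEdgeSet (E : Set (Sym2 V))).Reachable u v

variable {E F : Finset (Sym2 V)} {u v w x y : V}

lemma Conn.refl (E : Finset (Sym2 V)) (u : V) : Conn E u u := SimpleGraph.Reachable.refl u

lemma Conn.symm (h : Conn E u v) : Conn E v u := SimpleGraph.Reachable.symm h

lemma Conn.trans (h : Conn E u v) (h' : Conn E v w) : Conn E u w := SimpleGraph.Reachable.trans h h'

lemma Conn.of_mem (h : s(u, v) ∈ E) : Conn E u v := by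
  by_cases huv : u = v
  · subst huv; exact Conn.refl _ _
  · exact SimpleGraph.Adj.reachable (by simp [SimpleGraph.fromEdgeSet_adj, h, huv])

lemma Conn.induction {P : V → Prop} (h : Conn E u v) (hu : P u)
    (hstep : ∀ a b, s(a, b) ∈ E → P a → P b) : P v := by
  obtain ⟨p⟩ := h
  induction p with
  | nil => exact hu
  | cons hadj _ ih =>
    exact ih (hstep _ _ ((SimpleGraph.fromEdgeSet_adj _).1 hadj).1 hu)

/-- A map that sends the ends of every edge of `E` to connected vertices preserves connectivity. -/
lemma Conn.map {W : Type*} {F : Finset (Sym2 W)} (f : V → W) (h : Conn E u v)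
    (hf : ∀ a b, s(a, b) ∈ E → Conn F (f a) (f b)) : Conn F (f u) (f v) :=
  h.induction (P := fun z => Conn F (f u) (f z)) (Conn.refl _ _)
    fun a b hab ha => ha.trans (hf a b hab)

lemma Conn.of_edges (h : Conn E u v) (hf : ∀ a b, s(a, b) ∈ E → Conn F a b) : Conn F u v :=
  h.map id hf

lemma Conn.mono (hEF : E ⊆ F) (h : Conn E u v) : Conn F u v :=
  h.of_edges fun _ _ hab => Conn.of_mem (hEF hab)

variable [DecidableEq V]

/-- The alternative is invariant along a path from `u`: crossing the new edge leads to its far end,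
and crossing it back returns to the class of `u`. -/
lemma conn_insert (h : Conn (insert s(x, y) E) u v) :
    Conn E u v ∨ (Conn E u x ∧ Conn E y v) ∨ (Conn E u y ∧ Conn E x v) := by
  refine h.induction (P := fun v => Conn E u v ∨ (Conn E u x ∧ Conn E y v) ∨
    (Conn E u y ∧ Conn E x v)) (Or.inl (Conn.refl _ _)) ?_
  intro a b hab ha
  rcases Finset.mem_insert.1 hab with hab | hab
  · rcases Sym2.eq_iff.1 hab with ⟨rfl, rfl⟩ | ⟨rfl, rfl⟩
    · rcases ha with ha | ⟨ha, -⟩ | ⟨ha, -⟩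
      · exact Or.inr (Or.inl ⟨ha, Conn.refl _ _⟩)
      · exact Or.inr (Or.inl ⟨ha, Conn.refl _ _⟩)
      · exact Or.inl ha
    · rcases ha with ha | ⟨ha, -⟩ | ⟨ha, -⟩
      · exact Or.inr (Or.inr ⟨ha, Conn.refl _ _⟩)
      · exact Or.inl ha
      · exact Or.inr (Or.inr ⟨ha, Conn.refl _ _⟩)
  · have := Conn.of_mem hab
    rcases ha with ha | ⟨ha, ha'⟩ | ⟨ha, ha'⟩
    · exact Or.inl (ha.trans this)
    · exact Or.inr (Or.inl ⟨ha, ha'.trans this⟩)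
    · exact Or.inr (Or.inr ⟨ha, ha'.trans this⟩)

/-- If adding `E₂` to `E₁` connects `u` and `v`, then some edge of `E₂` does so when added to a
suitable set between `E₁` and `E₁ ∪ E₂`. -/
lemma exists_connecting_edge {E₁ E₂ : Finset (Sym2 V)} (h : ¬ Conn E₁ u v)
    (h' : Conn (E₁ ∪ E₂) u v) :
    ∃ F ⊆ E₂, ∃ e ∈ E₂, e ∉ F ∧ e ∉ E₁ ∧ ¬ Conn (E₁ ∪ F) u v ∧ Conn (insert e (E₁ ∪ F)) u v := by
  induction E₂ using Finset.induction_on with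
  | empty => simp_all
  | insert e E₂ he ih =>
    -- Adding the edges of `E₂` one at a time, the wanted edge is the one whose arrival connects `u`
    -- and `v`.
    by_cases h2 : Conn (E₁ ∪ E₂) u v
    · obtain ⟨F, hF, e', he', h3⟩ := ih h2
      exact ⟨F, hF.trans (Finset.subset_insert _ _), e', Finset.mem_insert_of_mem he', h3⟩
    · rw [Finset.union_insert] at h'
      refine ⟨E₂, Finset.subset_insert _ _, e, Finset.mem_insert_self _ _, he, ?_, h2, h'⟩
      intro heE
      rw [Finset.insert_eq_of_mem (Finset.mem_union_left _ heE)] at h'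
      exact h2 h'

end Conn

/-! ### Counting the components that meet a set -/

section NumClasses

variable {V : Type*}

open Classical in
/-- The number of connected components of `(V, E)` that meet `X`. -/
noncomputable def numClasses (E : Finset (Sym2 V)) (X : Finset V) : ℕ :=
  (X.image (SimpleGraph.fromEdgeSet (E : Set (Sym2 V))).connectedComponentMk).card

variable {E E' F : Finset (Sym2 V)} {X Y : Finset V} {u v x y : V}

lemma connectedComponentMk_eq_iff :
    (SimpleGraph.fromEdgeSet (E : Set (Sym2 V))).connectedComponentMk u =
      (SimpleGraph.fromEdgeSet (E : Set (Sym2 V))).connectedComponentMk v ↔ Conn E u v :=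
  SimpleGraph.ConnectedComponent.eq

lemma numClasses_eq
    [DecidableEq (SimpleGraph.fromEdgeSet (E : Set (Sym2 V))).ConnectedComponent] :
    numClasses E X =
      (X.image (SimpleGraph.fromEdgeSet (E : Set (Sym2 V))).connectedComponentMk).card := by
  unfold numClasses
  congr!

/-- On a set of representatives of the fibres of `f`, the map `g` is injective. -/
lemma card_image_le_of_forall_eq {ι κ : Type*} [DecidableEq ι] [DecidableEq κ] {f : V → ι}
    {g : V → κ} (h : ∀ u ∈ X, ∀ v ∈ X, g u = g v → f u = f v) :
    (X.image f).card ≤ (X.image g).card := by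
  obtain ⟨Y, hYX, hinj, hY⟩ := Finset.exists_subset_injOn_image_eq_of_surjOn (f := f)
    (s := (X : Set V)) (t := X.image f) (by intro i hi; simpa using hi)
  have hYX' : Y ⊆ X := by exact_mod_cast hYX
  rw [← hY, Finset.card_image_of_injOn hinj, ← Finset.card_image_of_injOn (f := g) (s := Y)]
  · exact Finset.card_le_card (Finset.image_subset_image hYX')
  · intro u hu v hv huv
    exact hinj hu hv (h u (hYX' hu) v (hYX' hv) huv)

lemma numClasses_eq_card_image {ι : Type*} [DecidableEq ι] (f : V → ι)
    (hf : ∀ u ∈ X, ∀ v ∈ X, f u = f v ↔ Conn E u v) : numClasses E X = (X.image f).card := by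
  classical
  rw [numClasses_eq]
  refine le_antisymm ?_ ?_
  · exact card_image_le_of_forall_eq fun u hu v hv h =>
      connectedComponentMk_eq_iff.2 ((hf u hu v hv).1 h)
  · exact card_image_le_of_forall_eq fun u hu v hv h =>
      (hf u hu v hv).2 (connectedComponentMk_eq_iff.1 h)

lemma numClasses_anti (h : E ⊆ E') : numClasses E' X ≤ numClasses E X := by
  classical
  simp only [numClasses_eq]
  refine (Finset.card_le_card ?_).trans (Finset.card_image_le (f :=
    SimpleGraph.ConnectedComponent.map (SimpleGraph.Hom.ofLE
      (SimpleGraph.fromEdgeSet_mono (Finset.coe_subset.2 h)))))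
  intro C hC
  obtain ⟨u, hu, rfl⟩ := Finset.mem_image.1 hC
  exact Finset.mem_image.2 ⟨_, Finset.mem_image_of_mem _ hu, rfl⟩

lemma numClasses_mono (h : X ⊆ Y) : numClasses E X ≤ numClasses E Y := by
  classical
  rw [numClasses_eq, numClasses_eq]
  exact Finset.card_le_card (Finset.image_subset_image h)

lemma numClasses_pos (hX : X.Nonempty) : 1 ≤ numClasses E X := by
  classical
  rw [numClasses_eq]
  exact Finset.card_pos.2 (hX.image _)

lemma numClasses_le_one (h : ∀ u ∈ X, ∀ v ∈ X, Conn E u v) : numClasses E X ≤ 1 := by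
  classical
  rw [numClasses_eq]
  refine Finset.card_le_one.2 ?_
  simp only [Finset.mem_image]
  rintro _ ⟨u, hu, rfl⟩ _ ⟨v, hv, rfl⟩
  exact connectedComponentMk_eq_iff.2 (h u hu v hv)

/-- Connecting the vertices of `Y` merges the classes that meet `Y`. -/
lemma numClasses_add_le (h : E ⊆ E') (hY : Y ⊆ X) (hne : Y.Nonempty)
    (hconn : ∀ u ∈ Y, ∀ v ∈ Y, Conn E' u v) :
    numClasses E' X + numClasses E Y ≤ numClasses E X + 1 := by
  classical
  obtain ⟨y, hy⟩ := hne
  set κ := (SimpleGraph.fromEdgeSet (E : Set (Sym2 V))).connectedComponentMk with hκ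
  set κ' := (SimpleGraph.fromEdgeSet (E' : Set (Sym2 V))).connectedComponentMk with hκ'
  set f := SimpleGraph.ConnectedComponent.map (SimpleGraph.Hom.ofLE
      (SimpleGraph.fromEdgeSet_mono (Finset.coe_subset.2 h)))
  -- All old classes that meet `Y` become the class of `y`; every other new class is the image of an
  -- old class that avoids `Y`.
  have hsub : X.image κ' ⊆ insert (κ' y) ((X.image κ \ Y.image κ).image f) := by
    intro C hC
    obtain ⟨u, hu, rfl⟩ := Finset.mem_image.1 hC
    by_cases huY : κ u ∈ Y.image κ
    · obtain ⟨z, hz, hzu⟩ := Finset.mem_image.1 huY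
      refine Finset.mem_insert.2 (Or.inl (connectedComponentMk_eq_iff.2 ?_))
      exact ((connectedComponentMk_eq_iff.1 hzu).symm.mono h).trans (hconn z hz y hy)
    · exact Finset.mem_insert_of_mem (Finset.mem_image.2
        ⟨κ u, Finset.mem_sdiff.2 ⟨Finset.mem_image_of_mem _ hu, huY⟩, rfl⟩)
  have h1 := Finset.card_le_card hsub
  have h2 := Finset.card_insert_le (κ' y) ((X.image κ \ Y.image κ).image f)
  have h3 := Finset.card_image_le (s := X.image κ \ Y.image κ) (f := f)
  have h4 := Finset.card_sdiff_add_card_eq_card (Finset.image_subset_image (f := κ) hY)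
  have e1 : numClasses E X = (X.image κ).card := numClasses_eq
  have e2 : numClasses E Y = (Y.image κ).card := numClasses_eq
  have e3 : numClasses E' X = (X.image κ').card := numClasses_eq
  omega

variable [DecidableEq V]

lemma two_le_numClasses (h : ¬ Conn E u v) : 2 ≤ numClasses E {u, v} := by
  classical
  rw [numClasses_eq, Finset.image_insert, Finset.image_singleton, Finset.card_pair]
  exact fun h' => h (connectedComponentMk_eq_iff.1 h')

lemma numClasses_insert_lt (hu : u ∈ X) (hv : v ∈ X) (h : ¬ Conn E u v)
    (h' : Conn (insert s(x, y) E) u v) :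
    numClasses (insert s(x, y) E) X + 1 ≤ numClasses E X := by
  have h1 := numClasses_add_le (Finset.subset_insert s(x, y) E) (X := X) (Y := {u, v})
    (by simp [Finset.insert_subset_iff, hu, hv]) (by simp) (by
      simp only [Finset.mem_insert, Finset.mem_singleton]
      rintro a (rfl | rfl) b (rfl | rfl)
      exacts [Conn.refl _ _, h', h'.symm, Conn.refl _ _])
  have h2 := two_le_numClasses h
  omega

/-- Only the classes of `x` and `y` can be merged, so the map to the new components is injective
away from the class of `x`. -/
lemma numClasses_le_insert (e : Sym2 V) : numClasses E X ≤ numClasses (insert e E) X + 1 := by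
  classical
  induction e using Sym2.ind with | _ x y
  set κ := (SimpleGraph.fromEdgeSet (E : Set (Sym2 V))).connectedComponentMk with hκ
  set κ' := (SimpleGraph.fromEdgeSet ((insert s(x, y) E : Finset _) : Set (Sym2 V))).connectedComponentMk
    with hκ'
  set f := SimpleGraph.ConnectedComponent.map (SimpleGraph.Hom.ofLE
      (SimpleGraph.fromEdgeSet_mono (Finset.coe_subset.2 (Finset.subset_insert s(x, y) E))))
  have h1 : ((X.image κ).erase (κ x)).card ≤ (X.image κ').card := by
    refine Finset.card_le_card_of_injOn f ?_ ?_
    · intro C hC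
      obtain ⟨u, hu, rfl⟩ := Finset.mem_image.1 (Finset.mem_of_mem_erase hC)
      exact Finset.mem_image_of_mem κ' hu
    · intro C hC D hD hCD
      have hC' := Finset.mem_erase.1 hC
      have hD' := Finset.mem_erase.1 hD
      obtain ⟨u, hu, rfl⟩ := Finset.mem_image.1 hC'.2
      obtain ⟨v, hv, rfl⟩ := Finset.mem_image.1 hD'.2
      have : Conn (insert s(x, y) E) u v := connectedComponentMk_eq_iff.1 hCD
      rcases conn_insert this with h | ⟨h, -⟩ | ⟨-, h⟩
      · exact connectedComponentMk_eq_iff.2 h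
      · exact absurd (connectedComponentMk_eq_iff.2 h) hC'.1
      · exact absurd (connectedComponentMk_eq_iff.2 h.symm) hD'.1
  have h2 := Finset.pred_card_le_card_erase (s := X.image κ) (a := κ x)
  have e1 : numClasses E X = (X.image κ).card := numClasses_eq
  have e2 : numClasses (insert s(x, y) E) X = (X.image κ').card := numClasses_eq
  omega

lemma numClasses_le_union (F : Finset (Sym2 V)) :
    numClasses E X ≤ numClasses (E ∪ F) X + F.card := by
  induction F using Finset.induction_on with
  | empty => simp
  | insert e F he ih =>
    have := numClasses_le_insert (E := E ∪ F) (X := X) e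
    rw [Finset.union_insert, Finset.card_insert_of_notMem he]
    omega

/-- The number of classes drops by at least one for each edge that is needed for connecting
vertices of `X`. -/
lemma numClasses_union_add_card_le
    (h : ∀ e ∈ F, ∃ u ∈ X, ∃ v ∈ X, ¬ Conn (E ∪ F.erase e) u v ∧ Conn (insert e E) u v) :
    numClasses (E ∪ F) X + F.card ≤ numClasses E X := by
  induction F using Finset.induction_on with
  | empty => simp
  | insert e F he ih =>
    -- The hypothesis passes to the smaller set because non-connection is inherited by fewer edges.
    have ih' := ih (fun e' he' => by
      obtain ⟨u, hu, v, hv, h1, h2⟩ := h e' (Finset.mem_insert_of_mem he')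
      refine ⟨u, hu, v, hv, fun h3 => h1 (h3.mono ?_), h2⟩
      exact Finset.union_subset_union_right (Finset.erase_subset_erase _ (Finset.subset_insert _ _)))
    obtain ⟨u, hu, v, hv, h1, h2⟩ := h e (Finset.mem_insert_self _ _)
    rw [Finset.erase_insert he] at h1
    rw [Finset.union_insert, Finset.card_insert_of_notMem he]
    induction e using Sym2.ind with | _ x y
    have := numClasses_insert_lt hu hv h1
      (h2.mono (Finset.insert_subset_insert _ Finset.subset_union_left))
    omega

/-- The partition of `R` into the classes of vertices that are connected by `E`. -/
lemma exists_finpartition (E : Finset (Sym2 V)) (R : Finset V) :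
    ∃ π : Finpartition R, π.parts.card = numClasses E R ∧ ∀ K ⊆ R,
      (π.parts.filter fun p => (K ∩ p).Nonempty).card = numClasses E K := by
  classical
  let κ : V → Finset V := fun r => R.filter (Conn E r)
  have hκ : ∀ u ∈ R, ∀ v ∈ R, κ u = κ v ↔ Conn E u v := by
    intro u hu v hv
    constructor
    · intro h
      have : v ∈ κ u := by rw [h]; simp [κ, hv, Conn.refl]
      exact (Finset.mem_filter.1 this).2
    · intro h
      ext w
      simp only [κ, Finset.mem_filter]
      exact and_congr_right fun _ => ⟨fun h' => h.symm.trans h', fun h' => h.trans h'⟩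
  let π : Finpartition R := Finpartition.ofExistsUnique (R.image κ)
    (by simp only [Finset.mem_image]; rintro _ ⟨r, -, rfl⟩; exact Finset.filter_subset _ _)
    (by
      intro a ha
      refine ⟨κ a, ⟨Finset.mem_image_of_mem _ ha, by simp [κ, ha, Conn.refl]⟩, ?_⟩
      rintro _ ⟨h1, h2⟩
      obtain ⟨r, hr, rfl⟩ := Finset.mem_image.1 h1
      exact (hκ r hr a ha).2 (Finset.mem_filter.1 h2).2)
    (by
      intro h
      obtain ⟨r, hr, h'⟩ := Finset.mem_image.1 h
      have : r ∈ κ r := by simp [κ, hr, Conn.refl]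
      simp [h'] at this)
  refine ⟨π, (numClasses_eq_card_image κ hκ).symm, fun K hK => ?_⟩
  rw [numClasses_eq_card_image κ fun u hu v hv => hκ u (hK hu) v (hK hv)]
  congr 1
  ext p
  simp only [Finset.mem_filter, Finset.mem_image]
  constructor
  · rintro ⟨h1, k, hk⟩
    obtain ⟨r, hr, rfl⟩ := Finset.mem_image.1 (show p ∈ R.image κ from h1)
    obtain ⟨hk1, hk2⟩ := Finset.mem_inter.1 hk
    exact ⟨k, hk1, ((hκ r hr k (hK hk1)).2 (Finset.mem_filter.1 hk2).2).symm⟩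
  · rintro ⟨k, hk, rfl⟩
    exact ⟨Finset.mem_image_of_mem κ (hK hk), k, Finset.mem_inter.2
      ⟨hk, by simp [κ, hK hk, Conn.refl]⟩⟩

end NumClasses

/-! ### Writing costs as sums over thresholds -/

/-- Weights on finitely many thresholds such that every `s ∈ S` is the total weight of the
thresholds below `s`. -/
lemma exists_threshold_weights (S : Finset ℝ≥0) :
    ∃ (W : Finset ℝ≥0) (w : ℝ≥0 → ℝ≥0), ∀ s ∈ S, ∑ v ∈ W with v < s, w v = s := by
  -- Strengthened for induction in increasing order: the total weight is the current maximum and all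
  -- thresholds lie below it. A new maximum `a` then only needs the old maximum `m` as a threshold,
  -- with weight `a - m`.
  suffices h : ∃ (W : Finset ℝ≥0) (w : ℝ≥0 → ℝ≥0), (∀ s ∈ S, ∑ v ∈ W with v < s, w v = s) ∧
      ∑ v ∈ W, w v = S.sup id ∧ ∀ v ∈ W, v < S.sup id from
    let ⟨W, w, h, _⟩ := h; ⟨W, w, h⟩
  induction S using Finset.induction_on_max with
  | empty => exact ⟨∅, 0, by simp⟩
  | insert a S ha ih =>
    obtain ⟨W, w, h1, h2, h3⟩ := ih
    set m := S.sup id with hm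
    have hsup : (insert a S).sup id = a := by
      rw [Finset.sup_insert]
      exact sup_eq_left.2 (Finset.sup_le fun s hs => (ha s hs).le)
    have hma : m ≤ a := Finset.sup_le fun s hs => (ha s hs).le
    have hmW : m ∉ W := fun h => (h3 m h).false
    rw [hsup]
    -- Equality occurs only for `S = ∅` and `a = 0`, the supremum of the empty set being `0`.
    rcases hma.eq_or_lt with hma | hma
    · refine ⟨W, w, ?_, by rw [h2, hma], fun v hv => hma ▸ h3 v hv⟩
      intro s hs
      rcases Finset.mem_insert.1 hs with rfl | hs
      · rw [Finset.filter_true_of_mem (fun v hv => hma ▸ h3 v hv), h2, hma]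
      · exact h1 s hs
    · have hsum : ∑ v ∈ insert m W, Function.update w m (a - m) v = a := by
        rw [Finset.sum_insert hmW, Function.update_self,
          Finset.sum_congr rfl (g := w) (fun v hv => Function.update_of_ne
            (fun h => hmW (by rw [← h]; exact hv)) _ _), h2]
        exact tsub_add_cancel_of_le hma.le
      have hlt : ∀ v ∈ insert m W, v < a := by
        intro v hv
        rcases Finset.mem_insert.1 hv with rfl | hv
        · exact hma
        · exact (h3 v hv).trans hma
      refine ⟨insert m W, Function.update w m (a - m), ?_, hsum, hlt⟩
      intro s hs
      rcases Finset.mem_insert.1 hs with rfl | hs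
      · rw [Finset.filter_true_of_mem hlt, hsum]
      · have hsm : s ≤ m := Finset.le_sup (f := id) hs
        rw [Finset.filter_insert, if_neg hsm.not_gt]
        refine (Finset.sum_congr rfl fun v hv => ?_).trans (h1 s hs)
        exact Function.update_of_ne (fun h => hmW (by rw [← h]; exact (Finset.mem_filter.1 hv).1)) _ _

section Thresholds

variable {V : Type*} [DecidableEq V]

/-- The thresholds `W` with weights `w` resolve the costs `c`. -/
def Resolves (c : Sym2 V → ℝ≥0) (W : Finset ℝ≥0) (w : ℝ≥0 → ℝ≥0) : Prop :=
  ∀ e, ∑ t ∈ W with t < c e, w t = c e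

omit [DecidableEq V] in
lemma exists_resolves [Fintype V] (c : Sym2 V → ℝ≥0) : ∃ W w, Resolves c W w := by
  classical
  obtain ⟨W, w, h⟩ := exists_threshold_weights (Finset.univ.image c)
  exact ⟨W, w, fun e => h _ (Finset.mem_image_of_mem _ (Finset.mem_univ e))⟩

variable {c : Sym2 V → ℝ≥0} {W : Finset ℝ≥0} {w : ℝ≥0 → ℝ≥0}

omit [DecidableEq V] in
-- Exchanging the sums over edges and thresholds turns comparisons of costs into comparisons of edge
-- counts.
lemma Resolves.cost_eq (h : Resolves c W w) (F : Finset (Sym2 V)) :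
    cost c F = ∑ t ∈ W, w t * ((F.filter fun e => t < c e).card : ℝ≥0) := by
  unfold cost
  rw [Finset.sum_congr rfl fun e _ => (h e).symm]
  simp_rw [Finset.sum_filter, Finset.card_filter]
  rw [Finset.sum_comm]
  refine Finset.sum_congr rfl fun t _ => ?_
  push_cast
  rw [Finset.mul_sum]
  refine Finset.sum_congr rfl fun e _ => ?_
  split_ifs <;> simp

end Thresholds

/-! ### Elementary cost estimates -/

section Cost

variable {V : Type*} {c : Sym2 V → ℝ≥0} {E F : Finset (Sym2 V)}

lemma cost_mono (h : E ⊆ F) : cost c E ≤ cost c F := Finset.sum_le_sum_of_subset h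

lemma cost_union_le [DecidableEq V] : cost c (E ∪ F) ≤ cost c E + cost c F := by
  unfold cost
  rw [← Finset.sum_union_inter]
  exact le_self_add

lemma cost_biUnion_le [DecidableEq V] {ι : Type*} (s : Finset ι) (f : ι → Finset (Sym2 V)) :
    cost c (s.biUnion f) ≤ ∑ i ∈ s, cost c (f i) := by
  classical
  induction s using Finset.induction_on with
  | empty => simp [cost]
  | insert i s hi ih =>
    rw [Finset.biUnion_insert, Finset.sum_insert hi]
    exact cost_union_le.trans (by gcongr)

lemma cost_sdiff_add [DecidableEq V] (h : E ⊆ F) : cost c (F \ E) + cost c E = cost c F :=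
  Finset.sum_sdiff h

end Cost

/-! ### Terminal spanning trees -/

section TST

variable {V : Type*} [Fintype V] [DecidableEq V] {G : SimpleGraph V} {c : Sym2 V → ℝ≥0}
  {R K : Finset V} {A B T F : Finset (Sym2 V)} {t : ℝ≥0}

omit [Fintype V] [DecidableEq V] in
lemma inTerminalNode_iff {v : V} : InTerminalNode R A v ↔ ∃ r ∈ R, Conn A v r := Iff.rfl

omit [Fintype V] [DecidableEq V] in
lemma InTerminalNode.mono {v : V} (h : A ⊆ B) (hv : InTerminalNode R A v) :
    InTerminalNode R B v :=
  let ⟨r, hr, hvr⟩ := hv; ⟨r, hr, Conn.mono h hvr⟩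

omit [Fintype V] in
lemma ConnectsTerminals.conn (h : ConnectsTerminals G R A T) {u v : V} (hu : u ∈ R) (hv : v ∈ R) :
    Conn (A ∪ T) u v := h.2 u hu v hv

omit [Fintype V] in
-- Otherwise the edge could be dropped, against minimality.
lemma IsTST.not_conn_erase (h : IsTST G R A T) {x y : V} (he : s(x, y) ∈ T) :
    ¬ Conn (A ∪ T.erase s(x, y)) x y := by
  intro hxy
  have h1 : ConnectsTerminals G R A (T.erase s(x, y)) := by
    refine ⟨fun e he => h.1.1 e (Finset.mem_of_mem_erase he), fun u hu v hv => ?_⟩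
    refine (h.1.conn hu hv).of_edges fun a b hab => ?_
    by_cases hab' : s(a, b) = s(x, y)
    · rcases Sym2.eq_iff.1 hab' with ⟨rfl, rfl⟩ | ⟨rfl, rfl⟩
      exacts [hxy, hxy.symm]
    · refine Conn.of_mem ?_
      rw [Finset.mem_union, Finset.mem_erase]
      exact (Finset.mem_union.1 hab).imp_right fun h => ⟨hab', h⟩
  exact absurd (h.2 h1 (Finset.erase_subset _ _) he) (Finset.notMem_erase _ _)

omit [Fintype V] in
lemma exists_isTST_subset (h : ConnectsTerminals G R A T) : ∃ T' ⊆ T, IsTST G R A T' := by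
  obtain ⟨T', hT', h'⟩ := exists_minimal_le_of_wellFoundedLT (ConnectsTerminals G R A) T h
  exact ⟨T', hT', h'⟩

omit [Fintype V] in
/-- A minimum terminal spanning tree costs at most as much as any set of edges that connects the
terminals. -/
lemma IsMTST.cost_le (h : IsMTST G c R A T) (h' : ConnectsTerminals G R A F) :
    cost c T ≤ cost c F := by
  obtain ⟨T', hT', h''⟩ := exists_isTST_subset h'
  exact (h.2 T' h'').trans (cost_mono hT')

open Classical in
/-- The contracted edges `A` and all edges of cost at most `t` of the terminal-induced subgraph of
`G / A`. -/
noncomputable def thresholdEdges (G : SimpleGraph V) (c : Sym2 V → ℝ≥0) (R : Finset V)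
    (A : Finset (Sym2 V)) (t : ℝ≥0) : Finset (Sym2 V) :=
  A ∪ Finset.univ.filter fun e =>
    e ∈ G.edgeSet ∧ c e ≤ t ∧ ∀ v ∈ e, InTerminalNode R A v

lemma mem_thresholdEdges {e : Sym2 V} : e ∈ thresholdEdges G c R A t ↔
    e ∈ A ∨ (e ∈ G.edgeSet ∧ c e ≤ t ∧ ∀ v ∈ e, InTerminalNode R A v) := by
  simp [thresholdEdges]

/-- Contraction can turn Steiner vertices into parts of terminal nodes but never the reverse, so
edges only become available. This makes `savings` antitone in the contracted set. -/
lemma thresholdEdges_mono (h : A ⊆ B) : thresholdEdges G c R A t ⊆ thresholdEdges G c R B t := by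
  intro e he
  rw [mem_thresholdEdges] at he ⊢
  exact he.imp (fun h' => h h') fun ⟨h1, h2, h3⟩ => ⟨h1, h2, fun v hv => (h3 v hv).mono h⟩

/-- If `F` lies in the terminal-induced subgraph of `G / A` and connects `K`, then the edges of `F`
above the threshold join the classes of `K`. -/
lemma numClasses_threshold_le (hF : ∀ e ∈ F, e ∈ G.edgeSet ∧ ∀ v ∈ e, InTerminalNode R A v)
    (hK : ∀ u ∈ K, ∀ v ∈ K, Conn (A ∪ F) u v) :
    numClasses (thresholdEdges G c R A t) K ≤ (F.filter fun e => t < c e).card + 1 := by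
  -- Together with the edges above the threshold everything in `K` is one class, and each added edge
  -- removes at most one class.
  refine (numClasses_le_union (F.filter fun e => t < c e)).trans ?_
  rw [add_comm]
  gcongr
  refine numClasses_le_one fun u hu v hv => (hK u hu v hv).mono ?_
  intro e he
  rcases Finset.mem_union.1 he with he | he
  · exact Finset.mem_union_left _ (mem_thresholdEdges.2 (Or.inl he))
  · by_cases hce : t < c e
    · exact Finset.mem_union_right _ (Finset.mem_filter.2 ⟨he, hce⟩)
    · exact Finset.mem_union_left _
        (mem_thresholdEdges.2 (Or.inr ⟨(hF e he).1, not_lt.1 hce, (hF e he).2⟩))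

/-- The edges of cost at most `t` of a minimum terminal spanning tree connect everything that the
edges of cost at most `t` connect. -/
lemma IsMTST.conn_of_mem_threshold (h : IsMTST G c R A T) {a b : V}
    (hab : s(a, b) ∈ thresholdEdges G c R A t) :
    Conn (A ∪ T.filter fun e => c e ≤ t) a b := by
  rcases mem_thresholdEdges.1 hab with hab | ⟨hG, hc, hN⟩
  · exact Conn.of_mem (Finset.mem_union_left _ hab)
  by_contra hcon
  obtain ⟨r, hr, har⟩ := inTerminalNode_iff.1 (hN a (Sym2.mem_mk_left _ _))
  obtain ⟨s, hs, hbs⟩ := inTerminalNode_iff.1 (hN b (Sym2.mem_mk_right _ _))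
  have hABT : Conn (A ∪ T) a b :=
    ((har.mono Finset.subset_union_left).trans (h.1.1.conn hr hs)).trans
      (hbs.mono Finset.subset_union_left).symm
  have hT : (A ∪ T.filter fun e => c e ≤ t) ∪ T = A ∪ T := by
    rw [Finset.union_assoc, Finset.union_eq_right.2 (Finset.filter_subset _ _)]
  -- Exchange argument: the tree joins `a` and `b` through some edge `f` that is not cheap.
  -- Replacing `f` by the cheap edge `s(a, b)` keeps the terminals connected at a strictly smaller
  -- cost.
  obtain ⟨F, hFT, f, hfT, hfF, hfA, h1, h2⟩ :=
    exists_connecting_edge (E₂ := T) hcon (by rwa [hT])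
  have hcf : t < c f := by
    by_contra hcf
    exact hfA (Finset.mem_union_right _ (Finset.mem_filter.2 ⟨hfT, not_lt.1 hcf⟩))
  have hsub : (A ∪ T.filter fun e => c e ≤ t) ∪ F ⊆ A ∪ T.erase f := by
    intro e he
    rcases Finset.mem_union.1 he with he | he
    · rcases Finset.mem_union.1 he with he' | he'
      · exact Finset.mem_union_left _ he'
      · refine Finset.mem_union_right _ (Finset.mem_erase.2 ⟨?_, (Finset.mem_filter.1 he').1⟩)
        rintro rfl
        exact hfA he
    · refine Finset.mem_union_right _ (Finset.mem_erase.2 ⟨?_, hFT he⟩)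
      rintro rfl
      exact hfF he
  have hnew : ConnectsTerminals G R A (insert s(a, b) (T.erase f)) := by
    refine ⟨?_, fun u hu v hv => ?_⟩
    · intro e he
      rcases Finset.mem_insert.1 he with rfl | he
      · exact ⟨hG, hN⟩
      · exact h.1.1.1 e (Finset.mem_of_mem_erase he)
    · refine (h.1.1.conn hu hv).of_edges fun x y hxy => ?_
      have hle : A ∪ T.erase f ⊆ A ∪ insert s(a, b) (T.erase f) :=
        Finset.union_subset_union_right (Finset.subset_insert _ _)
      by_cases hf : s(x, y) = f
      · subst hf
        have hab' : Conn (A ∪ insert s(a, b) (T.erase s(x, y))) a b :=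
          Conn.of_mem (Finset.mem_union_right _ (Finset.mem_insert_self _ _))
        rcases conn_insert h2 with h3 | ⟨h3, h4⟩ | ⟨h3, h4⟩
        · exact absurd h3 h1
        · exact (((h3.mono (hsub.trans hle)).symm).trans hab').trans
            (h4.mono (hsub.trans hle)).symm
        · exact (((h4.mono (hsub.trans hle))).trans hab'.symm).trans
            (h3.mono (hsub.trans hle))
      · refine Conn.of_mem (hle ?_)
        rw [Finset.mem_union, Finset.mem_erase]
        exact (Finset.mem_union.1 hxy).imp_right fun h => ⟨hf, h⟩
  have h3 := h.cost_le hnew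
  have h4 : cost c (T.erase f) + c f = cost c T := Finset.sum_erase_add _ _ hfT
  have h5 : cost c (insert s(a, b) (T.erase f)) ≤ c s(a, b) + cost c (T.erase f) := by
    rw [← Finset.singleton_union]
    refine cost_union_le.trans ?_
    simp [cost]
  have h6 := h3.trans h5
  rw [← h4, add_comm] at h6
  exact absurd ((add_le_add_iff_right _).1 h6) (not_le.2 (hc.trans_lt hcf))

/-- The number of edges above a threshold in a minimum terminal spanning tree. -/
lemma IsMTST.card_filter (h : IsMTST G c R A T) (hR : R.Nonempty) :
    (T.filter fun e => t < c e).card + 1 = numClasses (thresholdEdges G c R A t) R := by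
  -- One inequality holds for every connecting set; only the other needs minimality. There, the
  -- cheap tree edges already produce the classes of the threshold graph, and each remaining tree
  -- edge merges two of them.
  refine le_antisymm ?_ (numClasses_threshold_le h.1.1.1 h.1.1.2)
  have hunion : (A ∪ T.filter fun e => c e ≤ t) ∪ T.filter (fun e => t < c e) = A ∪ T := by
    rw [Finset.union_assoc]
    congr 1
    ext e
    simp only [Finset.mem_union, Finset.mem_filter]
    have := le_or_gt (c e) t
    tauto
  have h1 : numClasses (A ∪ T.filter fun e => c e ≤ t) R ≤
      numClasses (thresholdEdges G c R A t) R := by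
    classical
    rw [numClasses_eq, numClasses_eq]
    exact card_image_le_of_forall_eq fun u _ v _ huv => connectedComponentMk_eq_iff.2
      ((connectedComponentMk_eq_iff.1 huv).of_edges fun a b hab => h.conn_of_mem_threshold hab)
  have h2 : numClasses ((A ∪ T.filter fun e => c e ≤ t) ∪ T.filter fun e => t < c e) R +
      (T.filter fun e => t < c e).card ≤ numClasses (A ∪ T.filter fun e => c e ≤ t) R := by
    refine numClasses_union_add_card_le fun e he => ?_
    induction e using Sym2.ind with | _ x y
    have heT := (Finset.mem_filter.1 he).1
    obtain ⟨-, hN⟩ := h.1.1.1 _ heT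
    obtain ⟨r, hr, hxr⟩ := inTerminalNode_iff.1 (hN x (Sym2.mem_mk_left _ _))
    obtain ⟨s, hs, hys⟩ := inTerminalNode_iff.1 (hN y (Sym2.mem_mk_right _ _))
    -- The ends of a tree edge may be Steiner vertices inside terminal nodes, so the merged classes
    -- are witnessed by terminals `r` and `s` of these nodes.
    refine ⟨r, hr, s, hs, fun hrs => h.1.not_conn_erase heT ?_, ?_⟩
    · have := hrs.mono (F := A ∪ T.erase s(x, y)) (by
        intro e he'
        simp only [Finset.mem_union, Finset.mem_filter, Finset.mem_erase] at he he' ⊢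
        rcases he' with (he' | ⟨h1, h2⟩) | ⟨h1, h2, -⟩
        · exact Or.inl he'
        · refine Or.inr ⟨?_, h1⟩
          rintro rfl
          exact absurd he.2 (not_lt.2 h2)
        · exact Or.inr ⟨h1, h2⟩)
      exact ((hxr.mono Finset.subset_union_left).trans this).trans
        (hys.mono Finset.subset_union_left).symm
    · have hle : A ⊆ insert s(x, y) (A ∪ T.filter fun e => c e ≤ t) :=
        Finset.subset_union_left.trans (Finset.subset_insert _ _)
      exact ((hxr.mono hle).symm.trans (Conn.of_mem (Finset.mem_insert_self _ _))).trans
        (hys.mono hle)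
  have h3 := numClasses_pos (E := (A ∪ T.filter fun e => c e ≤ t) ∪ T.filter fun e => t < c e) hR
  omega

/-! ### Savings and the partition LP -/

variable {W : Finset ℝ≥0} {w : ℝ≥0 → ℝ≥0}

/-- The part of the cost of connecting the terminals of `G / A` that is saved by merging `K`. -/
noncomputable def savings (W : Finset ℝ≥0) (w : ℝ≥0 → ℝ≥0) (G : SimpleGraph V) (c : Sym2 V → ℝ≥0)
    (R : Finset V) (A : Finset (Sym2 V)) (K : Finset V) : ℝ :=
  ∑ t ∈ W, (w t : ℝ) * ((numClasses (thresholdEdges G c R A t) K : ℝ) - 1)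

lemma savings_anti (h : A ⊆ B) : savings W w G c R B K ≤ savings W w G c R A K := by
  unfold savings
  gcongr with t
  exact numClasses_anti (thresholdEdges_mono h)

omit [Fintype V] [DecidableEq V] in
lemma Resolves.coe_cost_eq (h : Resolves c W w) (F : Finset (Sym2 V)) :
    (cost c F : ℝ) = ∑ t ∈ W, (w t : ℝ) * ((F.filter fun e => t < c e).card : ℝ) := by
  rw [h.cost_eq]
  push_cast
  rfl

/-- At each threshold the edges of `F` above it have to join the classes of `K`. This is applied to
a shortcut tour of a component, and to a component minus its loss once the loss is contracted. -/
lemma Resolves.savings_le_cost (h : Resolves c W w)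
    (hF : ∀ e ∈ F, e ∈ G.edgeSet ∧ ∀ v ∈ e, InTerminalNode R A v)
    (hK : ∀ u ∈ K, ∀ v ∈ K, Conn (A ∪ F) u v) : savings W w G c R A K ≤ cost c F := by
  rw [h.coe_cost_eq]
  unfold savings
  gcongr with t
  have : (numClasses (thresholdEdges G c R A t) K : ℝ) ≤ (F.filter fun e => t < c e).card + 1 := by
    exact_mod_cast numClasses_threshold_le hF hK
  linarith

/-- Kruskal's count at every threshold. It puts tree costs into the same form as the partition
constraints. -/
lemma Resolves.cost_mtst_eq (h : Resolves c W w) (hT : IsMTST G c R A T) (hR : R.Nonempty) :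
    (cost c T : ℝ) = savings W w G c R A R := by
  rw [h.coe_cost_eq]
  unfold savings
  refine Finset.sum_congr rfl fun t _ => ?_
  rw [← hT.card_filter hR]
  push_cast
  ring

/-- Contracting a set of edges that connects `K` reduces the cost of a minimum terminal spanning
tree by at least the savings of `K`. -/
lemma savings_add_savings_le (hKR : K ⊆ R) (hK : K.Nonempty) (hAB : A ⊆ B)
    (hconn : ∀ u ∈ K, ∀ v ∈ K, Conn B u v) :
    savings W w G c R B R + savings W w G c R A K ≤ savings W w G c R A R := by
  unfold savings
  rw [← Finset.sum_add_distrib]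
  gcongr with t
  rw [← mul_add]
  gcongr
  have := numClasses_add_le (thresholdEdges_mono (G := G) (c := c) (R := R) (t := t) hAB) hKR hK
    fun u hu v hv => (hconn u hu v hv).mono fun e he => mem_thresholdEdges.2 (Or.inl he)
  have : (numClasses (thresholdEdges G c R B t) R : ℝ) + numClasses (thresholdEdges G c R A t) K ≤
    numClasses (thresholdEdges G c R A t) R + 1 := by exact_mod_cast this
  linarith

/-- The cost of a minimum terminal spanning tree is at most the fractional savings of a feasible
solution of the partition LP. -/
lemma Resolves.cost_mtst_le_sum (h : Resolves c W w) (hT : IsMTST G c R A T) (hR : R.Nonempty)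
    {x : Finset V → ℝ≥0} (hx : FeasibleP R x) :
    (cost c T : ℝ) ≤ ∑ K ∈ hyperedges R, (x K : ℝ) * savings W w G c R A K := by
  rw [h.cost_mtst_eq hT hR]
  have : ∑ K ∈ hyperedges R, (x K : ℝ) * savings W w G c R A K =
      ∑ t ∈ W, (w t : ℝ) * ∑ K ∈ hyperedges R, (x K : ℝ) *
        ((numClasses (thresholdEdges G c R A t) K : ℝ) - 1) := by
    unfold savings
    simp_rw [Finset.mul_sum]
    rw [Finset.sum_comm]
    exact Finset.sum_congr rfl fun t _ => Finset.sum_congr rfl fun K _ => by ring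
  rw [this]
  unfold savings
  gcongr with t
  -- The constraint of the LP for the partition of `R` into its classes at threshold `t` is exactly
  -- what is needed here.
  obtain ⟨π, h1, h2⟩ := exists_finpartition (thresholdEdges G c R A t) R
  rw [← h1]
  refine (hx π).trans_eq (Finset.sum_congr rfl fun K hK => ?_)
  rw [rankContribution, h2 K (Finset.mem_powerset.1 (Finset.mem_filter.1 hK).1)]

end TST

/-! ### Subtrees and their edge sets -/

section Trees

variable {V : Type*} [Fintype V] {G : SimpleGraph V} {H : G.Subgraph} {u v : V}

lemma mem_edges {e : Sym2 V} : e ∈ edges H ↔ e ∈ H.edgeSet := by simp [edges]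

lemma mk_mem_edges : s(u, v) ∈ edges H ↔ H.Adj u v := by simp [mem_edges]

lemma edges_subset {e : Sym2 V} (he : e ∈ edges H) : e ∈ G.edgeSet :=
  H.edgeSet_subset (mem_edges.1 he)

lemma mem_verts_of_mem_edges {e : Sym2 V} (he : e ∈ edges H) (hv : v ∈ e) : v ∈ H.verts :=
  H.mem_verts_of_mem_edge (mem_edges.1 he) hv

lemma Conn.mem_verts (h : Conn (edges H) u v) (hu : u ∈ H.verts) : v ∈ H.verts :=
  h.induction hu fun _ _ hab _ => H.edge_vert (mk_mem_edges.1 hab).symm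

/-- Every edge of `E` is a bridge. -/
def IsForest [DecidableEq V] (E : Finset (Sym2 V)) : Prop :=
  ∀ u v, s(u, v) ∈ E → ¬ Conn (E.erase s(u, v)) u v

lemma reachable_coe_iff (u v : H.verts) : H.coe.Reachable u v ↔ Conn (edges H) (u : V) v := by
  constructor
  · rintro ⟨p⟩
    induction p with
    | nil => exact Conn.refl _ _
    | cons hadj _ ih => exact (Conn.of_mem (mk_mem_edges.2 hadj)).trans ih
  · intro h
    have := h.induction (P := fun v => ∃ hv : v ∈ H.verts, H.coe.Reachable u ⟨v, hv⟩)
      ⟨u.2, SimpleGraph.Reachable.refl _⟩ (by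
        rintro a b hab ⟨ha, h'⟩
        have hadj := mk_mem_edges.1 hab
        refine ⟨H.edge_vert hadj.symm, h'.trans (SimpleGraph.Adj.reachable ?_)⟩
        exact hadj)
    exact this.2

/-- Moves from the graph on the subtype of vertices to edge sets on `V`, where contractions and
exchanges take place. -/
lemma isTree_coe_iff [DecidableEq V] : H.coe.IsTree ↔ H.verts.Nonempty ∧
    (∀ u ∈ H.verts, ∀ v ∈ H.verts, Conn (edges H) u v) ∧ IsForest (edges H) := by
  have key : H.coe.IsAcyclic ↔ IsForest (edges H) := by
    rw [SimpleGraph.isAcyclic_iff_forall_adj_isBridge]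
    have hdel : ∀ (u v a b : H.verts), (H.coe.deleteEdges {s(u, v)}).Adj a b ↔
        s((a : V), (b : V)) ∈ (edges H).erase s((u : V), (v : V)) := by
      intro u v a b
      rw [SimpleGraph.deleteEdges_adj, Finset.mem_erase, mk_mem_edges, and_comm]
      refine and_congr (not_congr ?_) Iff.rfl
      simp [Subtype.ext_iff]
    constructor
    · intro h u v huv hcon
      have hadj := mk_mem_edges.1 huv
      have hu := H.edge_vert hadj
      have hv := H.edge_vert hadj.symm
      have hb := h (v := ⟨u, hu⟩) (w := ⟨v, hv⟩) hadj
      rw [SimpleGraph.isBridge_iff] at hb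
      apply hb
      obtain ⟨hv', h'⟩ := hcon.induction (P := fun z => ∃ hz : z ∈ H.verts,
        (H.coe.deleteEdges {s((⟨u, hu⟩ : H.verts), ⟨v, hv⟩)}).Reachable ⟨u, hu⟩ ⟨z, hz⟩)
        ⟨hu, SimpleGraph.Reachable.refl _⟩ (by
          rintro a b hab ⟨ha, h'⟩
          have hb' : b ∈ H.verts :=
            mem_verts_of_mem_edges (Finset.mem_of_mem_erase hab) (Sym2.mem_mk_right _ _)
          exact ⟨hb', h'.trans (SimpleGraph.Adj.reachable
            ((hdel ⟨u, hu⟩ ⟨v, hv⟩ ⟨a, ha⟩ ⟨b, hb'⟩).2 hab))⟩)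
      exact h'
    · intro h u v hadj
      rw [SimpleGraph.isBridge_iff]
      rintro ⟨p⟩
      refine h u v (mk_mem_edges.2 hadj) ?_
      have : ∀ a b, (H.coe.deleteEdges {s(u, v)}).Walk a b →
          Conn ((edges H).erase s((u : V), (v : V))) a b := by
        intro a b p
        induction p with
        | nil => exact Conn.refl _ _
        | cons hadj _ ih => exact (Conn.of_mem ((hdel u v _ _).1 hadj)).trans ih
      exact this u v p
  rw [SimpleGraph.isTree_iff, key, SimpleGraph.connected_iff, and_comm (a := _ ∧ _)]
  constructor
  · rintro ⟨h1, h2, ⟨x⟩⟩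
    exact ⟨⟨x, x.2⟩, fun u hu v hv => (reachable_coe_iff ⟨u, hu⟩ ⟨v, hv⟩).1 (h2 _ _), h1⟩
  · rintro ⟨⟨x, hx⟩, h2, h1⟩
    exact ⟨h1, fun u v => (reachable_coe_iff u v).2 (h2 u u.2 v v.2), ⟨⟨x, hx⟩⟩⟩

/-- The subgraph with vertex set `X` and edge set `E`. -/
@[simps] def subgraphOf (G : SimpleGraph V) (X : Set V) (E : Finset (Sym2 V))
    (hE : ∀ e ∈ E, e ∈ G.edgeSet ∧ ∀ v ∈ e, v ∈ X) : G.Subgraph where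
  verts := X
  Adj u v := s(u, v) ∈ E
  adj_sub h := (hE _ h).1
  edge_vert h := (hE _ h).2 _ (Sym2.mem_mk_left _ _)
  symm := ⟨fun u v h => by rwa [Sym2.eq_swap]⟩

lemma edges_subgraphOf {X : Set V} {E : Finset (Sym2 V)}
    (hE : ∀ e ∈ E, e ∈ G.edgeSet ∧ ∀ v ∈ e, v ∈ X) : edges (subgraphOf G X E hE) = E := by
  ext e
  induction e using Sym2.ind with | _ x y
  rw [mk_mem_edges]
  rfl

variable [DecidableEq V] {R : Finset V} {E : Finset (Sym2 V)}

/-- A forest in which all edges are connected to a set of pairwise connected terminals is a Steiner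
tree. -/
lemma exists_steinerTree_of_isForest (hE : ∀ e ∈ E, e ∈ G.edgeSet) (hR : R.Nonempty)
    (hconn : ∀ u ∈ R, ∀ v ∈ R, Conn E u v) (hfor : IsForest E)
    (hend : ∀ e ∈ E, ∃ v ∈ e, InTerminalNode R E v) :
    ∃ S : G.Subgraph, IsSteinerTree G R S ∧ edges S = E := by
  obtain ⟨r, hr⟩ := hR
  have hE' : ∀ e ∈ E, e ∈ G.edgeSet ∧ ∀ v ∈ e, v ∈ {v | Conn E r v} := by
    refine fun e he => ⟨hE e he, fun v hv => ?_⟩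
    obtain ⟨u, hu, s, hs, hus⟩ := hend e he
    have huv : Conn E u v := by
      by_cases h : u = v
      · rw [h]; exact Conn.refl _ _
      · rw [(Sym2.mem_and_mem_iff h).1 ⟨hu, hv⟩] at he
        exact Conn.of_mem he
    exact ((hconn r hr s hs).trans (Conn.symm hus)).trans huv
  refine ⟨subgraphOf G {v | Conn E r v} E hE', ⟨?_, ?_⟩, edges_subgraphOf hE'⟩
  · rw [isTree_coe_iff, edges_subgraphOf]
    exact ⟨⟨r, Conn.refl _ _⟩, fun u hu v hv => Conn.trans (Conn.symm hu) hv, hfor⟩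
  · exact fun v hv => hconn r hr v hv

/-- Edges that connect the terminals contain a Steiner tree. -/
lemma exists_steinerTree (hE : ∀ e ∈ E, e ∈ G.edgeSet) (hR : R.Nonempty)
    (hconn : ∀ u ∈ R, ∀ v ∈ R, Conn E u v) :
    ∃ S : G.Subgraph, IsSteinerTree G R S ∧ edges S ⊆ E := by
  -- In a minimal connecting set, an edge on a cycle is superfluous, and so is an edge that no
  -- terminal reaches.
  obtain ⟨F, hFE, hF⟩ := exists_minimal_le_of_wellFoundedLT
    (fun F : Finset (Sym2 V) => ∀ u ∈ R, ∀ v ∈ R, Conn F u v) E hconn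
  have hmin : ∀ e ∈ F, ¬ ∀ u ∈ R, ∀ v ∈ R, Conn (F.erase e) u v := fun e he h =>
    absurd (hF.2 (y := F.erase e) h (Finset.erase_subset _ _) he) (Finset.notMem_erase _ _)
  have hfor : IsForest F := by
    intro u v huv hcon
    refine hmin _ huv fun r hr s hs => (hF.1 r hr s hs).of_edges fun a b hab => ?_
    by_cases h : s(a, b) = s(u, v)
    · rcases Sym2.eq_iff.1 h with ⟨rfl, rfl⟩ | ⟨rfl, rfl⟩
      exacts [hcon, hcon.symm]
    · exact Conn.of_mem (Finset.mem_erase.2 ⟨h, hab⟩)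
  have hend : ∀ e ∈ F, ∃ v ∈ e, InTerminalNode R F v := by
    intro e he
    by_contra! hno
    refine hmin e he fun r hr s hs => ?_
    refine ((hF.1 r hr s hs).induction (P := fun z => Conn F r z ∧ Conn (F.erase e) r z)
      ⟨Conn.refl _ _, Conn.refl _ _⟩ ?_).2
    rintro a b hab ⟨h1, h2⟩
    refine ⟨h1.trans (Conn.of_mem hab), h2.trans (Conn.of_mem (Finset.mem_erase.2 ⟨?_, hab⟩))⟩
    rintro rfl
    exact hno a (Sym2.mem_mk_left _ _) ⟨r, hr, h1.symm⟩
  obtain ⟨S, hS, hSF⟩ := exists_steinerTree_of_isForest (G := G) (fun e he => hE e (hFE he)) hR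
    hF.1 hfor hend
  exact ⟨S, hS, hSF ▸ hFE⟩

lemma steinerOpt_le {c : Sym2 V → ℝ≥0} (hE : ∀ e ∈ E, e ∈ G.edgeSet) (hR : R.Nonempty)
    (hconn : ∀ u ∈ R, ∀ v ∈ R, Conn E u v) : steinerOpt G c R ≤ cost c E := by
  obtain ⟨S, hS, hSE⟩ := exists_steinerTree hE hR hconn
  exact (iInf₂_le S hS).trans (by exact_mod_cast cost_mono hSE)

end Trees

/-! ### Doubling the edges of a tree -/

section Doubling

variable {V : Type*} [DecidableEq V] {c : Sym2 V → ℝ≥0}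

/-- The cost of moving from `a` to `b`. -/
def moveCost (c : Sym2 V → ℝ≥0) (a b : V) : ℝ≥0 := if a = b then 0 else c s(a, b)

/-- The cost of visiting the vertices of a list in order. -/
def tourCost (c : Sym2 V → ℝ≥0) : List V → ℝ≥0
  | [] => 0
  | [_] => 0
  | a :: b :: l => moveCost c a b + tourCost c (b :: l)

/-- The edges that are used when the vertices of a list are visited in order. -/
def tourEdges : List V → Finset (Sym2 V)
  | [] => ∅
  | [_] => ∅
  | a :: b :: l => (if a = b then ∅ else {s(a, b)}) ∪ tourEdges (b :: l)

lemma moveCost_comm (a b : V) : moveCost c a b = moveCost c b a := by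
  simp [moveCost, eq_comm, Sym2.eq_swap]

lemma moveCost_le (a b : V) : moveCost c a b ≤ c s(a, b) := by
  unfold moveCost; split_ifs <;> simp

/-- Setting the cost of staying to zero hides the unconstrained values of `c` on loops, so
coinciding vertices need no exception. -/
lemma moveCost_triangle
    (htri : ∀ u v w : V, u ≠ v → v ≠ w → u ≠ w → c s(u, w) ≤ c s(u, v) + c s(v, w)) (u v w : V) :
    moveCost c u w ≤ moveCost c u v + moveCost c v w := by
  unfold moveCost
  by_cases huw : u = w
  · simp [huw]
  by_cases huv : u = v
  · subst huv; simp
  by_cases hvw : v = w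
  · subst hvw; simp
  simpa [huw, huv, hvw] using htri u v w huv hvw huw

/-- Cuts a tour at a visited vertex, so that a detour can be spliced in there. -/
lemma tourCost_append (a : V) (l₁ l₂ : List V) :
    tourCost c (l₁ ++ a :: l₂) = tourCost c (l₁ ++ [a]) + tourCost c (a :: l₂) := by
  induction l₁ with
  | nil => simp [tourCost]
  | cons x l₁ ih =>
    cases l₁ with
    | nil => simp [tourCost]
    | cons y l₁ =>
      simp only [List.cons_append, tourCost] at ih ⊢
      rw [ih, add_assoc]

lemma tourCost_cons_le_of_sublist
    (htri : ∀ u v w : V, u ≠ v → v ≠ w → u ≠ w → c s(u, w) ≤ c s(u, v) + c s(v, w))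
    {l l' : List V} (h : l'.Sublist l) (a : V) : tourCost c (a :: l') ≤ tourCost c (a :: l) := by
  induction h generalizing a with
  | slnil => exact le_rfl
  | @cons l' l b _ ih =>
    cases l' with
    | nil => exact zero_le
    | cons x l' =>
      have := ih b
      simp only [tourCost] at this ⊢
      calc moveCost c a x + tourCost c (x :: l')
          ≤ (moveCost c a b + moveCost c b x) + tourCost c (x :: l') := by
            gcongr; exact moveCost_triangle htri _ _ _
        _ = moveCost c a b + (moveCost c b x + tourCost c (x :: l')) := add_assoc _ _ _
        _ ≤ _ := by gcongr
  | cons_cons b _ ih => simp only [tourCost]; gcongr; exact ih b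

lemma cost_tourEdges_le (l : List V) : cost c (tourEdges l) ≤ tourCost c l := by
  induction l with
  | nil => simp [tourEdges, cost]
  | cons a l ih =>
    cases l with
    | nil => simp [tourEdges, cost]
    | cons b l =>
      simp only [tourEdges, tourCost]
      refine cost_union_le.trans (add_le_add ?_ ih)
      unfold moveCost
      split_ifs <;> simp [cost]

lemma mem_of_mem_tourEdges {l : List V} {e : Sym2 V} (he : e ∈ tourEdges l) :
    ¬ e.IsDiag ∧ ∀ v ∈ e, v ∈ l := by
  induction l with
  | nil => simp [tourEdges] at he
  | cons a l ih =>
    cases l with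
    | nil => simp [tourEdges] at he
    | cons b l =>
      simp only [tourEdges, Finset.mem_union] at he
      rcases he with he | he
      · split_ifs at he with hab
        · simp at he
        · obtain rfl := Finset.mem_singleton.1 he
          simp [hab]
      · exact ⟨(ih he).1, fun v hv => List.mem_cons_of_mem _ ((ih he).2 v hv)⟩

lemma conn_tourEdges (a : V) (l : List V) : ∀ v ∈ a :: l, Conn (tourEdges (a :: l)) a v := by
  induction l generalizing a with
  | nil => simp [Conn.refl]
  | cons b l ih =>
    intro v hv
    rcases List.mem_cons.1 hv with rfl | hv
    · exact Conn.refl _ _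
    · refine Conn.trans ?_ ((ih b v hv).mono Finset.subset_union_right)
      by_cases hab : a = b
      · subst hab; exact Conn.refl _ _
      · exact Conn.of_mem (by simp [tourEdges, hab])

/-- A closed walk that starts in `a` and visits everything that `E` connects to `a`. -/
lemma exists_tour (E : Finset (Sym2 V)) (a : V) :
    ∃ l : List V, tourCost c (a :: l) ≤ 2 * cost c E ∧ ∀ v, Conn E a v → v ∈ a :: l := by
  classical
  let P : Finset (Sym2 V) → Prop := fun F => ∃ l : List V, tourCost c (a :: l) ≤ 2 * cost c F ∧
    ∀ e ∈ F, ∀ v ∈ e, v ∈ a :: l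
  -- Take a largest part of `E` covered by a tour of at most twice its cost. If an edge of `E` led
  -- from a visited `x` to an unvisited `y`, the detour `x, y, x` would cover that edge as well, at
  -- an extra cost of at most `2 * c s(x, y)`.
  obtain ⟨F, hF, hmax⟩ := Finset.exists_max_image (E.powerset.filter P) Finset.card
    ⟨∅, Finset.mem_filter.2 ⟨Finset.empty_mem_powerset _, [], by simp [tourCost], by simp⟩⟩
  obtain ⟨hFE, l, hl, hFl⟩ := Finset.mem_filter.1 hF
  rw [Finset.mem_powerset] at hFE
  refine ⟨l, hl.trans (by gcongr; exact cost_mono hFE), fun v hv => ?_⟩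
  refine hv.induction (List.mem_cons_self) fun x y hxy hx => ?_
  by_contra hy
  have hxyF : s(x, y) ∉ F := fun h => hy (hFl _ h y (Sym2.mem_mk_right _ _))
  obtain ⟨l₁, l₂, hl12⟩ := List.append_of_mem hx
  have hhead : ∃ l', l₁ ++ x :: y :: x :: l₂ = a :: l' := by
    cases l₁ with
    | nil =>
      simp only [List.nil_append, List.cons.injEq] at hl12
      exact ⟨_, by rw [hl12.1]; rfl⟩
    | cons b l₁ =>
      simp only [List.cons_append, List.cons.injEq] at hl12
      exact ⟨_, by rw [hl12.1]; rfl⟩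
  obtain ⟨l', hl'⟩ := hhead
  have hcost : tourCost c (a :: l') = tourCost c (a :: l) + 2 * moveCost c x y := by
    rw [← hl', hl12, tourCost_append x l₁ l₂, tourCost_append x l₁]
    simp only [tourCost]
    rw [moveCost_comm y x]
    ring
  have hP : P (insert s(x, y) F) := by
    refine ⟨l', ?_, ?_⟩
    · have : cost c (insert s(x, y) F) = c s(x, y) + cost c F := Finset.sum_insert hxyF
      rw [hcost, this, mul_add, add_comm]
      gcongr
      exact moveCost_le _ _
    · have hsub : ∀ z, z ∈ a :: l → z ∈ a :: l' := by
        intro z hz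
        rw [← hl']
        rw [hl12] at hz
        simp only [List.mem_append, List.mem_cons] at hz ⊢
        tauto
      intro e he v hv
      rcases Finset.mem_insert.1 he with rfl | he
      · rcases Sym2.mem_iff.1 hv with rfl | rfl
        · exact hsub _ hx
        · rw [← hl']; simp
      · exact hsub _ (hFl e he v hv)
  have h1 := hmax (insert s(x, y) F) (Finset.mem_filter.2
    ⟨Finset.mem_powerset.2 (Finset.insert_subset hxy hFE), hP⟩)
  rw [Finset.card_insert_of_notMem hxyF] at h1
  omega

/-- In a metric, edges between the vertices of `K` connect `K` at no more than twice the cost of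
any set of edges that connects `K`. -/
lemma exists_connecting_le_two_mul
    (htri : ∀ u v w : V, u ≠ v → v ≠ w → u ≠ w → c s(u, w) ≤ c s(u, v) + c s(v, w))
    {E : Finset (Sym2 V)} {K : Finset V} (hK : ∀ u ∈ K, ∀ v ∈ K, Conn E u v) :
    ∃ F : Finset (Sym2 V), (∀ e ∈ F, ¬ e.IsDiag ∧ ∀ v ∈ e, v ∈ K) ∧
      (∀ u ∈ K, ∀ v ∈ K, Conn F u v) ∧ cost c F ≤ 2 * cost c E := by
  rcases K.eq_empty_or_nonempty with rfl | ⟨a, ha⟩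
  · exact ⟨∅, by simp [cost]⟩
  obtain ⟨l, hl, hconn⟩ := exists_tour (c := c) E a
  -- Deleting the vertices outside `K` from the tour does not raise its cost, by the triangle
  -- inequality.
  have hF : ∀ v ∈ K, Conn (tourEdges (a :: l.filter (· ∈ K))) a v := by
    intro v hv
    refine conn_tourEdges _ _ v ?_
    have := hconn v (hK a ha v hv)
    simp only [List.mem_cons, List.mem_filter, decide_eq_true_eq] at this ⊢
    exact this.imp_right fun h => ⟨h, hv⟩
  refine ⟨tourEdges (a :: l.filter (· ∈ K)), fun e he => ⟨(mem_of_mem_tourEdges he).1, ?_⟩,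
    fun u hu v hv => (hF u hu).symm.trans (hF v hv), ?_⟩
  · intro v hv
    have := (mem_of_mem_tourEdges he).2 v hv
    simp only [List.mem_cons, List.mem_filter, decide_eq_true_eq] at this
    rcases this with rfl | h
    exacts [ha, h.2]
  · exact (cost_tourEdges_le _).trans
      ((tourCost_cons_le_of_sublist htri List.filter_sublist a).trans hl)

end Doubling

/-! ### The loss of a full component -/

section Loss

variable {V : Type*} [Fintype V] [DecidableEq V] {G : SimpleGraph V} {H : G.Subgraph}
  {c : Sym2 V → ℝ≥0} {R K : Finset V}

omit [Fintype V] [DecidableEq V] in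
-- The rank is the distance to `r`; only the existence of a descending step is used.
lemma exists_rank (E : Finset (Sym2 V)) (r : V) :
    ∃ d : V → ℕ, ∀ v, Conn E v r → v ≠ r → ∃ w, s(v, w) ∈ E ∧ d w < d v := by
  refine ⟨fun v => (SimpleGraph.fromEdgeSet (E : Set (Sym2 V))).dist v r, fun v hv hne => ?_⟩
  obtain ⟨p, hp⟩ := hv.exists_walk_length_eq_dist
  cases p with
  | nil => exact absurd rfl hne
  | @cons _ w _ hadj q =>
    refine ⟨w, by exact_mod_cast ((SimpleGraph.fromEdgeSet_adj _).1 hadj).1, ?_⟩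
    have := SimpleGraph.dist_le q
    simp only [SimpleGraph.Walk.length_cons] at hp
    dsimp only
    omega

omit [Fintype V] in
/-- In a tree, at most one neighbour of `v` is not farther from the root than `v`. -/
lemma IsForest.eq_of_rank_le {E : Finset (Sym2 V)} (hE : IsForest E) {r v w₁ w₂ : V} {d : V → ℕ}
    (hd : ∀ v, Conn E v r → v ≠ r → ∃ w, s(v, w) ∈ E ∧ d w < d v) (hr : ∀ u, s(v, u) ∈ E → Conn E u r)
    (h₁ : s(v, w₁) ∈ E) (h₂ : s(v, w₂) ∈ E) (hd₁ : d w₁ ≤ d v) (hd₂ : d w₂ ≤ d v) : w₁ = w₂ := by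
  by_contra hne
  have hnl : ∀ w, s(v, w) ∈ E → w ≠ v := by
    rintro w hw rfl
    exact hE w w hw (Conn.refl _ _)
  -- From a vertex other than `v` of rank at most `d v`, a descending path reaches the root without
  -- meeting `v`. Two such neighbours of `v` would therefore close a cycle through `v`.
  have key : ∀ n z, d z ≤ n → Conn E z r → z ≠ v → d z ≤ d v →
      Conn (E.erase s(v, w₁)) z r := by
    intro n
    induction n with
    | zero =>
      intro z hz hzr _ _
      by_cases h : z = r
      · rw [h]; exact Conn.refl _ _
      · obtain ⟨w, -, hw⟩ := hd z hzr h
        omega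
    | succ n ih =>
      intro z hz hzr hzv hzd
      by_cases h : z = r
      · rw [h]; exact Conn.refl _ _
      · obtain ⟨w, hwE, hw⟩ := hd z hzr h
        have hwv : w ≠ v := by rintro rfl; omega
        refine (Conn.of_mem (Finset.mem_erase.2 ⟨?_, hwE⟩)).trans
          (ih w (by omega) ((Conn.of_mem hwE).symm.trans hzr) hwv (by omega))
        intro h'
        rcases Sym2.eq_iff.1 h' with ⟨h', -⟩ | ⟨-, h'⟩
        exacts [hzv h', hwv h']
  have h1 := key _ w₁ le_rfl (hr _ h₁) (hnl _ h₁) hd₁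
  have h2 := key _ w₂ le_rfl (hr _ h₂) (hnl _ h₂) hd₂
  have h3 : Conn (E.erase s(v, w₁)) v w₂ := by
    refine Conn.of_mem (Finset.mem_erase.2 ⟨fun h => ?_, h₂⟩)
    rcases Sym2.eq_iff.1 h with ⟨-, h⟩ | ⟨-, h⟩
    · exact hne h.symm
    · exact hnl _ h₂ h
  exact hE v w₁ h₁ (h3.trans (h2.trans h1.symm))

/-- If all Steiner vertices have degree at least three, then some set of edges that connects all
vertices of the component to terminals has at most half of its cost. -/
lemma exists_connectsToTerminals_half (hH : H.coe.IsTree)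
    (hdeg : ∀ v ∈ H.verts, v ∉ R → 3 ≤ (H.neighborSet v).ncard) :
    ∃ L, ConnectsToTerminals R H L ∧ 2 * cost c L ≤ cost c (edges H) := by
  classical
  obtain ⟨⟨r, hr⟩, hconn, hfor⟩ := isTree_coe_iff.1 hH
  obtain ⟨d, hd⟩ := exists_rank (edges H) r
  -- Of at least three neighbours at most one is not farther from the root, so two children remain.
  have hchild : ∀ v, v ∈ H.verts ∧ v ∉ R → ∃ w₁ w₂, H.Adj v w₁ ∧ H.Adj v w₂ ∧ d v < d w₁ ∧
      d v < d w₂ ∧ w₁ ≠ w₂ := by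
    rintro v ⟨hv, hvR⟩
    have hsub : {w ∈ H.neighborSet v | d w ≤ d v}.ncard ≤ 1 := by
      rw [Set.ncard_le_one]
      rintro a ⟨ha, hda⟩ b ⟨hb, hdb⟩
      exact hfor.eq_of_rank_le hd
        (fun u hu => hconn u (H.edge_vert (mk_mem_edges.1 hu).symm) r hr)
        (mk_mem_edges.2 ha) (mk_mem_edges.2 hb) hda hdb
    have h2 : H.neighborSet v \ {w ∈ H.neighborSet v | d w ≤ d v} =
        {w ∈ H.neighborSet v | d v < d w} := by
      ext w
      simp only [Set.mem_sdiff, Set.mem_ofPred_eq, not_and, not_le]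
      tauto
    have h3 := Set.ncard_sdiff_add_ncard_of_subset
      (Set.sep_subset (H.neighborSet v) (fun w => d w ≤ d v))
    rw [h2] at h3
    have h4 := hdeg v hv hvR
    obtain ⟨a, b, ha, hb, hab⟩ := (Set.one_lt_ncard_iff
      (s := {w ∈ H.neighborSet v | d v < d w})).1 (by omega)
    exact ⟨a, b, ha.1, hb.1, ha.2, hb.2, hab⟩
  choose! m₁ m₂ hadj₁ hadj₂ hd₁ hd₂ hne using hchild
  let X : Finset V := Finset.univ.filter fun v => v ∈ H.verts ∧ v ∉ R
  have hX : ∀ v, v ∈ X ↔ v ∈ H.verts ∧ v ∉ R := by simp [X]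
  -- Repeatedly moving to the chosen child increases the rank and must end in a terminal. Two
  -- different choices of children use disjoint edge sets, so the cheaper one costs at most half of
  -- the component.
  have key : ∀ m : V → V, (∀ v, v ∈ H.verts ∧ v ∉ R → H.Adj v (m v)) →
      (∀ v, v ∈ H.verts ∧ v ∉ R → d v < d (m v)) →
      ConnectsToTerminals R H (X.image fun v => s(v, m v)) := by
    intro m hadj hdm
    refine ⟨?_, ?_⟩
    · intro e he
      obtain ⟨v, hv, rfl⟩ := Finset.mem_image.1 he
      exact mk_mem_edges.2 (hadj v ((hX v).1 hv))
    · by_contra! hcon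
      let Y : Finset V := Finset.univ.filter fun v => v ∈ H.verts ∧ ∀ r ∈ R, r ∈ H.verts →
        ¬ Conn (X.image fun v => s(v, m v)) v r
      obtain ⟨v₀, hv₀, hv₀'⟩ := hcon
      obtain ⟨v, hv, hmax⟩ := Finset.exists_max_image Y d
        ⟨v₀, Finset.mem_filter.2 ⟨Finset.mem_univ _, hv₀, hv₀'⟩⟩
      obtain ⟨-, hvH, hv'⟩ := Finset.mem_filter.1 hv
      have hvR : v ∉ R := fun h => hv' v h hvH (Conn.refl _ _)
      have hmem : s(v, m v) ∈ X.image fun v => s(v, m v) :=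
        Finset.mem_image_of_mem _ ((hX v).2 ⟨hvH, hvR⟩)
      have hmY : m v ∈ Y := Finset.mem_filter.2 ⟨Finset.mem_univ _,
        H.edge_vert (hadj v ⟨hvH, hvR⟩).symm, fun r hr hrH h =>
          hv' r hr hrH ((Conn.of_mem hmem).trans h)⟩
      exact absurd (hmax _ hmY) (not_le.2 (hdm v ⟨hvH, hvR⟩))
  have h1 := key m₁ hadj₁ hd₁
  have h2 := key m₂ hadj₂ hd₂
  have hdisj : Disjoint (X.image fun v => s(v, m₁ v)) (X.image fun v => s(v, m₂ v)) := by
    rw [Finset.disjoint_left]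
    intro e he he'
    obtain ⟨v, hv, rfl⟩ := Finset.mem_image.1 he
    obtain ⟨w, hw, hvw⟩ := Finset.mem_image.1 he'
    rw [hX] at hv hw
    have h3 := hd₁ v hv
    have h4 := hd₂ w hw
    rcases Sym2.eq_iff.1 hvw with ⟨rfl, h⟩ | ⟨h, h'⟩
    · exact hne w hw h.symm
    · rw [h'] at h4
      rw [← h] at h3
      omega
  have h3 : cost c (X.image fun v => s(v, m₁ v)) + cost c (X.image fun v => s(v, m₂ v)) ≤
      cost c (edges H) := by
    unfold cost
    rw [← Finset.sum_union hdisj]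
    exact cost_mono (Finset.union_subset h1.1 h2.1)
  rcases le_total (cost c (X.image fun v => s(v, m₁ v))) (cost c (X.image fun v => s(v, m₂ v)))
    with h | h
  · exact ⟨_, h1, by rw [two_mul]; exact (by gcongr : _ ≤ _).trans h3⟩
  · exact ⟨_, h2, by rw [two_mul]; exact (by gcongr : _ ≤ _).trans h3⟩

lemma IsLoss.two_mul_cost_le {L : Finset (Sym2 V)} (hL : IsLoss c R H L) (hH : H.coe.IsTree)
    (hdeg : ∀ v ∈ H.verts, v ∉ R → 3 ≤ (H.neighborSet v).ncard) :
    2 * cost c L ≤ cost c (edges H) := by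
  obtain ⟨L', h1, h2⟩ := exists_connectsToTerminals_half (c := c) hH hdeg
  exact (mul_le_mul_right (hL.2.1 L' h1) _).trans h2

/-- Every full component has a loss. -/
lemma exists_isLoss (hH : H.coe.IsTree) (hR : ∃ r ∈ R, r ∈ H.verts) : ∃ L, IsLoss c R H L := by
  classical
  obtain ⟨-, hconn, -⟩ := isTree_coe_iff.1 hH
  obtain ⟨r₀, hr₀, hr₀H⟩ := hR
  obtain ⟨L₀, hL₀, hmin₀⟩ := Finset.exists_min_image
    (Finset.univ.filter fun L => ConnectsToTerminals R H L) (cost c)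
    ⟨edges H, Finset.mem_filter.2 ⟨Finset.mem_univ _, subset_rfl, fun v hv =>
      ⟨r₀, hr₀, hr₀H, hconn v hv r₀ hr₀H⟩⟩⟩
  -- Edges of cost zero make minimum cost insufficient for separating terminals, so an
  -- inclusion-minimal set among the cheapest is taken.
  obtain ⟨L, -, hL⟩ := exists_minimal_le_of_wellFoundedLT
    (fun L => ConnectsToTerminals R H L ∧ ∀ L', ConnectsToTerminals R H L' → cost c L ≤ cost c L')
    L₀ ⟨(Finset.mem_filter.1 hL₀).2, fun L' hL' =>
      hmin₀ L' (Finset.mem_filter.2 ⟨Finset.mem_univ _, hL'⟩)⟩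
  refine ⟨L, hL.1.1, hL.1.2, fun r hr s hs hrs => ?_⟩
  by_contra hne
  have h0 : ¬ Conn ∅ r s := by
    intro h
    exact hne (h.induction (P := fun v => r = v) rfl (by simp))
  -- If `r` and `s` were connected, the edge `f` between them could be dropped, as each of its ends
  -- still reaches one of the two.
  obtain ⟨F, hFL, f, hfL, hfF, -, h1, h2⟩ :=
    exists_connecting_edge (E₁ := ∅) (E₂ := L) h0 (by rwa [Finset.empty_union])
  rw [Finset.empty_union] at h1 h2
  have hsub : F ⊆ L.erase f := fun e he =>
    Finset.mem_erase.2 ⟨fun h => hfF (h ▸ he), hFL he⟩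
  have hverts : ∀ v ∈ H.verts, ∃ r ∈ R, r ∈ H.verts ∧ Conn (L.erase f) v r := by
    induction f using Sym2.ind with | _ x y
    have hxy := mk_mem_edges.1 (hL.1.1.1 hfL)
    have hend : ∀ z, z = x ∨ z = y → ∃ r ∈ R, r ∈ H.verts ∧ Conn (L.erase s(x, y)) z r := by
      have hx := H.edge_vert hxy
      have hy := H.edge_vert hxy.symm
      have aux : ∀ z r, z ∈ H.verts → Conn F z r → r ∈ H.verts := fun z r hz h =>
        (h.mono (hFL.trans hL.1.1.1)).mem_verts hz
      rcases conn_insert h2 with h | ⟨h3, h4⟩ | ⟨h3, h4⟩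
      · exact absurd h h1
      · rintro z (rfl | rfl)
        · exact ⟨r, hr, aux _ _ hx h3.symm, h3.symm.mono hsub⟩
        · exact ⟨s, hs, aux _ _ hy h4, h4.mono hsub⟩
      · rintro z (rfl | rfl)
        · exact ⟨s, hs, aux _ _ hx h4, h4.mono hsub⟩
        · exact ⟨r, hr, aux _ _ hy h3.symm, h3.symm.mono hsub⟩
    intro v hv
    obtain ⟨q, hq, hqH, hvq⟩ := hL.1.1.2 v hv
    have hvq' : Conn (insert s(x, y) (L.erase s(x, y))) v q := by
      rw [Finset.insert_erase hfL]; exact hvq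
    rcases conn_insert hvq' with h | ⟨h, -⟩ | ⟨h, -⟩
    · exact ⟨q, hq, hqH, h⟩
    · obtain ⟨q', h1, h2, h3⟩ := hend x (Or.inl rfl)
      exact ⟨q', h1, h2, h.trans h3⟩
    · obtain ⟨q', h1, h2, h3⟩ := hend y (Or.inr rfl)
      exact ⟨q', h1, h2, h.trans h3⟩
  refine absurd (hL.2 (y := L.erase f) ⟨⟨(Finset.erase_subset _ _).trans hL.1.1.1, hverts⟩,
    fun L' hL' => (cost_mono (Finset.erase_subset _ _)).trans (hL.1.2 L' hL')⟩
    (Finset.erase_subset _ _) hfL) (Finset.notMem_erase _ _)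

end Loss

/-! ### The choices of the heuristic can be made -/

section Shortcut

variable {V : Type*} [Fintype V] [DecidableEq V] {c : Sym2 V → ℝ≥0} {R K : Finset V}

/-- A Steiner vertex of degree two can be replaced by an edge between its neighbours. -/
lemma exists_shortcut {H : (⊤ : SimpleGraph V).Subgraph}
    (htri : ∀ u v w : V, u ≠ v → v ≠ w → u ≠ w → c s(u, w) ≤ c s(u, v) + c s(v, w))
    (hH : IsFullComponent ⊤ R K H) {v : V} (hv : v ∈ H.verts) (hvR : v ∉ R)
    (hdeg : (H.neighborSet v).ncard < 3) :
    ∃ H' : (⊤ : SimpleGraph V).Subgraph, IsFullComponent ⊤ R K H' ∧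
      cost c (edges H') ≤ cost c (edges H) ∧ H'.verts = H.verts \ {v} := by
  obtain ⟨hT, hK, hleaf⟩ := hH
  obtain ⟨-, hconn, hfor⟩ := isTree_coe_iff.1 hT
  have hns : ¬ (H.neighborSet v).Subsingleton := fun h => hvR ((hleaf v hv).2 h)
  have h2 : (H.neighborSet v).ncard = 2 := by
    have : 1 < (H.neighborSet v).ncard := by
      rw [Set.one_lt_ncard_iff_nontrivial]
      exact Set.not_subsingleton_iff.1 hns
    omega
  obtain ⟨a, b, hab, hN⟩ := Set.ncard_eq_two.1 h2
  have hva : H.Adj v a := by rw [← SimpleGraph.Subgraph.mem_neighborSet, hN]; simp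
  have hvb : H.Adj v b := by rw [← SimpleGraph.Subgraph.mem_neighborSet, hN]; simp
  have hvN : ∀ w, H.Adj v w → w = a ∨ w = b := fun w hw => by
    rw [← SimpleGraph.Subgraph.mem_neighborSet, hN] at hw; simpa using hw
  have hav : a ≠ v := (H.adj_sub hva).ne'
  have hbv : b ≠ v := (H.adj_sub hvb).ne'
  -- A tree has no triangle, so the shortcut `s(a, b)` is a new edge.
  have hnab : ¬ H.Adj a b := by
    intro h
    refine hfor v a (mk_mem_edges.2 hva) ?_
    refine (Conn.of_mem (v := b) ?_).trans (Conn.of_mem ?_)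
    · exact Finset.mem_erase.2 ⟨by simp [hab.symm, hav.symm], mk_mem_edges.2 hvb⟩
    · exact Finset.mem_erase.2 ⟨by simp [hav, hbv], mk_mem_edges.2 h.symm⟩
  set E := edges H with hE
  set E₀ := (E.erase s(v, a)).erase s(v, b) with hE₀
  set E' := insert s(a, b) E₀ with hE'
  have hE₀E : E₀ ⊆ E := (Finset.erase_subset _ _).trans (Finset.erase_subset _ _)
  have hE₀v : ∀ x y, s(x, y) ∈ E₀ → x ≠ v := by
    rintro x y hxy rfl
    rw [hE₀, Finset.mem_erase, Finset.mem_erase] at hxy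
    rcases hvN y (mk_mem_edges.1 hxy.2.2) with rfl | rfl
    exacts [hxy.2.1 rfl, hxy.1 rfl]
  have habE₀ : s(a, b) ∉ E₀ := fun h => hnab (mk_mem_edges.1 (hE₀E h))
  have hmem : ∀ x y, s(x, y) ∈ E → x ≠ v → y ≠ v → s(x, y) ∈ E₀ := by
    intro x y hxy hx hy
    rw [hE₀, Finset.mem_erase, Finset.mem_erase]
    refine ⟨?_, ?_, hxy⟩ <;> intro h <;> rcases Sym2.eq_iff.1 h with h | h <;> tauto
  have hsub : ∀ e ∈ E', e ∈ (⊤ : SimpleGraph V).edgeSet ∧ ∀ x ∈ e, x ∈ H.verts \ {v} := by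
    intro e he
    rcases Finset.mem_insert.1 he with rfl | he
    · refine ⟨by simpa using hab, ?_⟩
      intro x hx
      rcases Sym2.mem_iff.1 hx with rfl | rfl
      · exact ⟨H.edge_vert hva.symm, hav⟩
      · exact ⟨H.edge_vert hvb.symm, hbv⟩
    · refine ⟨edges_subset (hE₀E he), fun x hx => ⟨mem_verts_of_mem_edges (hE₀E he) hx, ?_⟩⟩
      obtain ⟨y, rfl⟩ := Sym2.mem_iff_exists.1 hx
      exact hE₀v x y he
  refine ⟨subgraphOf ⊤ (H.verts \ {v}) E' hsub, ⟨?_, ?_, ?_⟩, ?_, rfl⟩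
  · rw [isTree_coe_iff, edges_subgraphOf]
    refine ⟨⟨a, H.edge_vert hva.symm, hav⟩, ?_, ?_⟩
    · rintro x ⟨hx, hxv⟩ y ⟨hy, hyv⟩
      -- Sliding `v` onto `a` maps old paths to new ones: `s(v, a)` collapses and `s(v, b)` becomes
      -- the shortcut.
      have := (hconn x hx y hy).map (F := E') (fun z => if z = v then a else z) (by
        intro p q hpq
        by_cases hp : p = v
        · subst hp
          rw [if_pos rfl]
          rcases hvN q (mk_mem_edges.1 hpq) with rfl | rfl
          · rw [if_neg hav]; exact Conn.refl _ _
          · rw [if_neg hbv]; exact Conn.of_mem (Finset.mem_insert_self _ _)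
        · rw [if_neg hp]
          by_cases hq : q = v
          · subst hq
            rw [if_pos rfl]
            rcases hvN p (mk_mem_edges.1 hpq).symm with rfl | rfl
            · exact Conn.refl _ _
            · exact Conn.symm (Conn.of_mem (Finset.mem_insert_self _ _))
          · rw [if_neg hq]
            exact Conn.of_mem (Finset.mem_insert_of_mem (hmem p q hpq hp hq)))
      rwa [if_neg (show x ≠ v from hxv), if_neg (show y ≠ v from hyv)] at this
    · intro p q hpq hcon
      by_cases hpqab : s(p, q) = s(a, b)
      · rw [hpqab, hE', Finset.erase_insert habE₀] at hcon
        have hab' : Conn E₀ a b := by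
          rcases Sym2.eq_iff.1 hpqab with ⟨rfl, rfl⟩ | ⟨rfl, rfl⟩
          exacts [hcon, hcon.symm]
        refine hfor v a (mk_mem_edges.2 hva) ?_
        refine (Conn.of_mem (v := b) ?_).trans (hab'.symm.mono (Finset.erase_subset _ _))
        exact Finset.mem_erase.2 ⟨by simp [hab.symm, hav.symm], mk_mem_edges.2 hvb⟩
      · have hpqE₀ : s(p, q) ∈ E₀ := Finset.mem_of_mem_insert_of_ne hpq hpqab
        -- A cycle that uses the shortcut lifts to one through `a`, `v`, `b` in the old tree.
        refine hfor p q (hE₀E hpqE₀) (hcon.of_edges fun x y hxy => ?_)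
        obtain ⟨hne, hxy⟩ := Finset.mem_erase.1 hxy
        have hpv := hE₀v p q hpqE₀
        have hqv := hE₀v q p (by rwa [Sym2.eq_swap])
        have hava : Conn (E.erase s(p, q)) v a := Conn.of_mem
          (Finset.mem_erase.2 ⟨by simp [hpv.symm, hqv.symm], mk_mem_edges.2 hva⟩)
        have havb : Conn (E.erase s(p, q)) v b := Conn.of_mem
          (Finset.mem_erase.2 ⟨by simp [hpv.symm, hqv.symm], mk_mem_edges.2 hvb⟩)
        rcases Finset.mem_insert.1 hxy with h | h
        · rcases Sym2.eq_iff.1 h with ⟨rfl, rfl⟩ | ⟨rfl, rfl⟩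
          exacts [hava.symm.trans havb, havb.symm.trans hava]
        · exact Conn.of_mem (Finset.mem_erase.2 ⟨hne, hE₀E h⟩)
  · rw [← hK]
    ext x
    simp only [subgraphOf_verts, Set.mem_inter_iff, Set.mem_sdiff, Set.mem_singleton_iff]
    constructor
    · rintro ⟨⟨h1, -⟩, h2⟩; exact ⟨h1, h2⟩
    · rintro ⟨h1, h2⟩
      exact ⟨⟨h1, fun h => hvR (h ▸ h2)⟩, h2⟩
  · rintro x ⟨hx, hxv⟩
    rw [hleaf x hx]
    -- At `a` and `b` the neighbour `v` is exchanged for the opposite end of the shortcut. Degrees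
    -- do not change, and hence leaves remain leaves.
    have hadj : ∀ y, s(x, y) ∈ E' ↔ (x = a ∧ y = b) ∨ (x = b ∧ y = a) ∨ (H.Adj x y ∧ y ≠ v) := by
      intro y
      rw [hE', Finset.mem_insert, Sym2.eq_iff, or_assoc]
      refine or_congr_right (or_congr_right ⟨fun h => ⟨mk_mem_edges.1 (hE₀E h), ?_⟩,
        fun h => hmem x y (mk_mem_edges.2 h.1) hxv h.2⟩)
      exact hE₀v y x (by rwa [Sym2.eq_swap])
    have hxv' : H.Adj x v ↔ x = a ∨ x = b := by
      refine ⟨fun h => hvN x h.symm, ?_⟩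
      rintro (rfl | rfl)
      exacts [hva.symm, hvb.symm]
    have hnba : ¬ H.Adj b a := fun h => hnab h.symm
    constructor
    · intro hs y (hy : s(x, y) ∈ E') z (hz : s(x, z) ∈ E')
      rw [hadj] at hy hz
      by_cases hxab : x = a ∨ x = b
      · have hall : ∀ w, H.Adj x w → w = v := fun w hw => hs hw (hxv'.2 hxab)
        have := hall y
        have := hall z
        rcases hxab with rfl | rfl <;> simp only [true_and, hab, hab.symm, false_and, false_or]
          at hy hz <;> grind
      · push Not at hxab
        simp only [hxab.1, hxab.2, false_and, false_or] at hy hz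
        exact hs hy.1 hz.1
    · intro hs y hy z hz
      have hs' : ∀ p q, s(x, p) ∈ E' → s(x, q) ∈ E' → p = q := fun p q hp hq => hs hp hq
      have hy' : H.Adj x y := hy
      have hz' : H.Adj x z := hz
      simp only [hadj] at hs'
      by_cases hyv : y = v <;> by_cases hzv : z = v
      · rw [hyv, hzv]
      · subst hyv
        rcases hxv'.1 hy' with rfl | rfl
        · have := hs' z b (by simp [hz', hzv]) (by simp); subst this; exact absurd hz' hnab
        · have := hs' z a (by simp [hz', hzv]) (by simp); subst this; exact absurd hz' hnba
      · subst hzv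
        rcases hxv'.1 hz' with rfl | rfl
        · have := hs' y b (by simp [hy', hyv]) (by simp); subst this; exact absurd hy' hnab
        · have := hs' y a (by simp [hy', hyv]) (by simp); subst this; exact absurd hy' hnba
      · exact hs' y z (by simp [hy', hyv]) (by simp [hz', hzv])
  · rw [edges_subgraphOf]
    have h1 : cost c E' = c s(a, b) + cost c E₀ := Finset.sum_insert habE₀
    have h3 : cost c (E.erase s(v, a)) + c s(v, a) = cost c E :=
      Finset.sum_erase_add _ _ (mk_mem_edges.2 hva)
    have h4 : cost c E₀ + c s(v, b) = cost c (E.erase s(v, a)) := by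
      refine Finset.sum_erase_add _ _ (Finset.mem_erase.2 ⟨?_, mk_mem_edges.2 hvb⟩)
      simp [hab.symm, hav.symm]
    have h5 := htri a v b hav hbv.symm hab
    rw [h1, ← h3, ← h4, add_comm, add_assoc]
    gcongr
    rw [Sym2.eq_swap (a := v) (b := a), add_comm]
    exact h5

/-- A minimum-cost full component without Steiner vertices of degree two. -/
lemma exists_min_component
    (htri : ∀ u v w : V, u ≠ v → v ≠ w → u ≠ w → c s(u, w) ≤ c s(u, v) + c s(v, w))
    (hK : ∃ H : (⊤ : SimpleGraph V).Subgraph, IsFullComponent ⊤ R K H) :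
    ∃ H : (⊤ : SimpleGraph V).Subgraph, IsFullComponent ⊤ R K H ∧
      (∀ H', IsFullComponent ⊤ R K H' → cost c (edges H) ≤ cost c (edges H')) ∧
      ∀ v ∈ H.verts, v ∉ R → 3 ≤ (H.neighborSet v).ncard := by
  -- Minimising cost first and number of vertices second excludes degree two, since a shortcut
  -- removes a vertex at no extra cost.
  obtain ⟨H, hH, hmin⟩ := Set.exists_min_image
    {H : (⊤ : SimpleGraph V).Subgraph | IsFullComponent ⊤ R K H}
    (fun H => toLex (cost c (edges H), H.verts.ncard)) (Set.toFinite _) hK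
  have hmin' : ∀ H', IsFullComponent ⊤ R K H' → cost c (edges H) < cost c (edges H') ∨
      cost c (edges H) = cost c (edges H') ∧ H.verts.ncard ≤ H'.verts.ncard := fun H' hH' => by
    simpa [Prod.Lex.le_iff] using hmin H' hH'
  refine ⟨H, hH, fun H' hH' => ?_, fun v hv hvR => ?_⟩
  · rcases hmin' H' hH' with h | h
    exacts [h.le, h.1.le]
  · by_contra! hlt
    obtain ⟨H', hH', hcost, hverts⟩ := exists_shortcut htri hH hv hvR hlt
    rcases hmin' H' hH' with h | ⟨-, h⟩
    · exact absurd hcost (not_le.2 h)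
    · rw [hverts] at h
      exact absurd h (not_le.2 (Set.ncard_sdiff_singleton_lt_of_mem hv))

lemma exists_isMTST (A : Finset (Sym2 V)) : ∃ T, IsMTST ⊤ c R A T := by
  classical
  have hconn : ConnectsTerminals ⊤ R A (Finset.univ.filter fun e : Sym2 V =>
      e ∈ (⊤ : SimpleGraph V).edgeSet ∧ ∀ v ∈ e, InTerminalNode R A v) := by
    refine ⟨fun e he => (Finset.mem_filter.1 he).2, fun u hu v hv => ?_⟩
    by_cases huv : u = v
    · rw [huv]
    · refine Conn.of_mem (Finset.mem_union_right _ (Finset.mem_filter.2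
        ⟨Finset.mem_univ _, by simpa using huv, fun x hx => ?_⟩))
      rcases Sym2.mem_iff.1 hx with rfl | rfl
      exacts [⟨_, hu, SimpleGraph.Reachable.refl _⟩, ⟨_, hv, SimpleGraph.Reachable.refl _⟩]
  obtain ⟨T₀, -, hT₀⟩ := exists_isTST_subset hconn
  obtain ⟨T, hT, hmin⟩ := Finset.exists_min_image (Finset.univ.filter fun T => IsTST ⊤ R A T)
    (cost c) ⟨T₀, by simpa using hT₀⟩
  exact ⟨T, by simpa using hT, fun T' hT' => hmin T' (by simpa using hT')⟩

omit [Fintype V] [DecidableEq V] in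
lemma IsFullComponent.exists_terminal {G : SimpleGraph V} {H : G.Subgraph}
    (hH : IsFullComponent G R K H) (hK : K.Nonempty) : ∃ r ∈ R, r ∈ H.verts := by
  obtain ⟨k, hk⟩ := hK
  have : k ∈ H.verts ∩ (R : Set V) := by rw [hH.2.1]; exact hk
  exact ⟨k, this.2, this.1⟩

omit [Fintype V] [DecidableEq V] in
lemma IsSpannedHyperedge.nonempty {G : SimpleGraph V} (hK : IsSpannedHyperedge G R K) :
    K.Nonempty := (Finset.mem_filter.1 hK.1).2

omit [Fintype V] [DecidableEq V] in
lemma IsSpannedHyperedge.subset {G : SimpleGraph V} (hK : IsSpannedHyperedge G R K) :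
    K ⊆ R := Finset.mem_powerset.1 (Finset.mem_filter.1 hK.1).1

theorem nonempty_choices {G : SimpleGraph V} (h : IsMetricInstance G c) :
    Nonempty (Choices G c R) := by
  obtain ⟨rfl, htri⟩ := h
  have hcomp : ∀ K, ∃ H : (⊤ : SimpleGraph V).Subgraph, IsSpannedHyperedge ⊤ R K →
      IsFullComponent ⊤ R K H ∧
      (∀ H', IsFullComponent ⊤ R K H' → cost c (edges H) ≤ cost c (edges H')) ∧
      ∀ v ∈ H.verts, v ∉ R → 3 ≤ (H.neighborSet v).ncard := by
    intro K
    by_cases hK : IsSpannedHyperedge ⊤ R K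
    · obtain ⟨H, hH⟩ := exists_min_component htri hK.2
      exact ⟨H, fun _ => hH⟩
    -- Nothing is required of hyperedges that are not spanned, so any value serves.
    · exact ⟨⊥, fun h => absurd h hK⟩
  choose comp hcomp using hcomp
  have hloss : ∀ K, ∃ L, IsSpannedHyperedge ⊤ R K → IsLoss c R (comp K) L := by
    intro K
    by_cases hK : IsSpannedHyperedge ⊤ R K
    · obtain ⟨L, hL⟩ := exists_isLoss (c := c) (hcomp K hK).1.1
        ((hcomp K hK).1.exists_terminal hK.nonempty)
      exact ⟨L, fun _ => hL⟩
    · exact ⟨∅, fun h => absurd h hK⟩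
  choose loss hloss using hloss
  choose mtst hmtst using fun A => exists_isMTST (c := c) (R := R) A
  exact ⟨⟨comp, fun K hK => (hcomp K hK).1, fun K hK => (hcomp K hK).2.1,
    fun K hK => (hcomp K hK).2.2, loss, hloss, mtst, hmtst⟩⟩

end Shortcut

/-! ### The run of the heuristic -/

namespace Choices

variable {V : Type*} [Fintype V] [DecidableEq V] {G : SimpleGraph V} {c : Sym2 V → ℝ≥0}
  {R : Finset V} (𝒞 : Choices G c R)

/-- Contracting the loss absorbs all Steiner vertices of the component, so its remaining edges
become available to terminal spanning trees. -/
lemma inTerminalNode_loss {K : Finset V} (hK : IsSpannedHyperedge G R K) {v : V}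
    (hv : v ∈ (𝒞.comp K).verts) : InTerminalNode R (𝒞.loss K) v :=
  let ⟨r, hr, _, h⟩ := (𝒞.loss_spec K hK).1.2 v hv
  ⟨r, hr, h⟩

/-- Every vertex of the component already reaches a terminal through the loss, so contracting the
rest creates no further terminal nodes. -/
lemma inTerminalNode_of_union_edges {K : Finset V} (hK : IsSpannedHyperedge G R K)
    {A : Finset (Sym2 V)} {v : V} (h : InTerminalNode R (A ∪ edges (𝒞.comp K)) v) :
    InTerminalNode R (A ∪ 𝒞.loss K) v := by
  obtain ⟨r, hr, hvr⟩ := h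
  refine (Conn.symm hvr).induction (P := InTerminalNode R (A ∪ 𝒞.loss K))
    ⟨r, hr, Conn.refl _ _⟩ ?_
  rintro a b hab ⟨s, hs, has⟩
  rcases Finset.mem_union.1 hab with hab | hab
  · exact ⟨s, hs, (Conn.of_mem (Finset.mem_union_left _ hab)).symm.trans has⟩
  · exact (𝒞.inTerminalNode_loss hK (mem_verts_of_mem_edges hab (Sym2.mem_mk_right _ _))).mono
      Finset.subset_union_right

/-- A tree for the contracted component, together with the component's edges outside the loss,
connects the terminals when only the loss is contracted. This converts gain into a decrease of the
tree cost. -/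
lemma cost_mtst_union_loss_le {K : Finset V} (hK : IsSpannedHyperedge G R K)
    (A : Finset (Sym2 V)) :
    cost c (𝒞.mtst (A ∪ 𝒞.loss K)) + cost c (𝒞.loss K) ≤
      cost c (𝒞.mtst (A ∪ edges (𝒞.comp K))) + cost c (edges (𝒞.comp K)) := by
  have hLE := (𝒞.loss_spec K hK).1.1
  have hT := (𝒞.mtst_spec (A ∪ edges (𝒞.comp K))).1.1
  have hconn : ConnectsTerminals G R (A ∪ 𝒞.loss K)
      (𝒞.mtst (A ∪ edges (𝒞.comp K)) ∪ (edges (𝒞.comp K) \ 𝒞.loss K)) := by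
    refine ⟨fun e he => ?_, fun u hu v hv => (hT.conn hu hv).mono ?_⟩
    · rcases Finset.mem_union.1 he with he | he
      · exact ⟨(hT.1 e he).1, fun v hv => 𝒞.inTerminalNode_of_union_edges hK ((hT.1 e he).2 v hv)⟩
      · have he' := (Finset.mem_sdiff.1 he).1
        exact ⟨edges_subset he', fun v hv => (𝒞.inTerminalNode_loss hK
          (mem_verts_of_mem_edges he' hv)).mono Finset.subset_union_right⟩
    · intro e he
      simp only [Finset.mem_union, Finset.mem_sdiff] at he ⊢
      tauto
  rw [← cost_sdiff_add (c := c) hLE, ← add_assoc]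
  gcongr
  exact ((𝒞.mtst_spec _).cost_le hconn).trans cost_union_le

/-! ### Savings during the run -/

variable {W : Finset ℝ≥0} {w : ℝ≥0 → ℝ≥0}

lemma conn_edges_comp {K : Finset V} (hK : IsSpannedHyperedge G R K) :
    ∀ u ∈ K, ∀ v ∈ K, Conn (edges (𝒞.comp K)) u v := by
  have h := 𝒞.comp_full K hK
  have hsub : ∀ u ∈ K, u ∈ (𝒞.comp K).verts := by
    intro u hu
    have : u ∈ (𝒞.comp K).verts ∩ (R : Set V) := by rw [h.2.1]; exact hu
    exact this.1
  exact fun u hu v hv => (isTree_coe_iff.1 h.1).2.1 u (hsub u hu) v (hsub v hv)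

/-- Merging `K` accounts for only part of the drop, as contracting the whole component may also make
Steiner vertices available. This direction suffices for rejected components. -/
lemma savings_le_drop (h : Resolves c W w) (hR : R.Nonempty) {K : Finset V}
    (hK : IsSpannedHyperedge G R K) (A : Finset (Sym2 V)) :
    savings W w G c R A K ≤ 𝒞.drop A K := by
  unfold drop
  rw [h.cost_mtst_eq (𝒞.mtst_spec _) hR, h.cost_mtst_eq (𝒞.mtst_spec _) hR]
  have := savings_add_savings_le (W := W) (w := w) (G := G) (c := c) (A := A) hK.subset hK.nonempty
    (Finset.subset_union_left (s₂ := edges (𝒞.comp K)))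
    fun u hu v hv => (𝒞.conn_edges_comp hK u hu v hv).mono Finset.subset_union_right
  linarith

/-- Once the loss is contracted, the other edges of the component suffice to connect `K`. This
bounds the savings of accepted components. -/
lemma savings_add_loss_le (h : Resolves c W w) {K : Finset V} (hK : IsSpannedHyperedge G R K)
    {A : Finset (Sym2 V)} (hA : 𝒞.loss K ⊆ A) :
    savings W w G c R A K + cost c (𝒞.loss K) ≤ cost c (edges (𝒞.comp K)) := by
  have h1 := h.savings_le_cost (G := G) (R := R) (A := A) (K := K)
    (F := edges (𝒞.comp K) \ 𝒞.loss K) (fun e he => by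
      have he' := (Finset.mem_sdiff.1 he).1
      exact ⟨edges_subset he', fun v hv => (𝒞.inTerminalNode_loss hK
        (mem_verts_of_mem_edges he' hv)).mono hA⟩)
    (fun u hu v hv => (𝒞.conn_edges_comp hK u hu v hv).mono (by
      intro e he
      by_cases heL : e ∈ 𝒞.loss K
      · exact Finset.mem_union_left _ (hA heL)
      · exact Finset.mem_union_right _ (Finset.mem_sdiff.2 ⟨he, heL⟩)))
  have h2 : (cost c (edges (𝒞.comp K) \ 𝒞.loss K) : ℝ) + cost c (𝒞.loss K) =
      cost c (edges (𝒞.comp K)) := by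
    exact_mod_cast cost_sdiff_add (c := c) (𝒞.loss_spec K hK).1.1
  linarith

omit [Fintype V] in
lemma cost_biUnion_toFinset_le {ι : Type*} [DecidableEq ι] (f : ι → Finset (Sym2 V))
    (l : List ι) : cost c (l.toFinset.biUnion f) ≤ (l.map fun K => cost c (f K)).sum := by
  induction l with
  | nil => simp [cost]
  | cons K l ih =>
    rw [List.toFinset_cons, Finset.biUnion_insert, List.map_cons, List.sum_cons]
    exact cost_union_le.trans (by gcongr)

lemma accepted_sublist (α : ℝ) (A : Finset (Sym2 V)) (Ks : List (Finset V)) :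
    (𝒞.accepted α A Ks).Sublist Ks := by
  induction Ks generalizing A with
  | nil => exact List.Sublist.refl _
  | cons K Ks ih =>
    unfold accepted
    split_ifs
    · exact (ih _).cons_cons K
    · exact (ih _).cons K

/-- The final contracted graph: every contracted loss has been paid for, and no component has
large savings. -/
lemma accepted_spec (h : Resolves c W w) (hR : R.Nonempty) {α : ℝ} (hα : 0 ≤ α)
    (Ks : List (Finset V)) (hKs : ∀ K ∈ Ks, IsSpannedHyperedge G R K) (A : Finset (Sym2 V)) :
    α * ((𝒞.accepted α A Ks).map fun K => cost c (𝒞.loss K)).sum +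
        cost c (𝒞.mtst (A ∪ (𝒞.accepted α A Ks).toFinset.biUnion 𝒞.loss)) ≤
      cost c (𝒞.mtst A) ∧
    ∀ K ∈ Ks, savings W w G c R (A ∪ (𝒞.accepted α A Ks).toFinset.biUnion 𝒞.loss) K ≤
      cost c (edges (𝒞.comp K)) + (α - 1) * cost c (𝒞.loss K) := by
  induction Ks generalizing A with
  | nil => simp [accepted]
  | cons K Ks ih =>
    have hK := hKs K List.mem_cons_self
    have hKs' : ∀ K ∈ Ks, IsSpannedHyperedge G R K := fun K' h => hKs K' (List.mem_cons_of_mem _ h)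
    have hpos : (0 : ℝ) ≤ cost c (𝒞.loss K) := NNReal.coe_nonneg _
    unfold accepted
    split_ifs with hgain
    · obtain ⟨h1, h2⟩ := ih hKs' (A ∪ 𝒞.loss K)
      rw [List.toFinset_cons, Finset.biUnion_insert, ← Finset.union_assoc]
      refine ⟨?_, fun K' hK' => ?_⟩
      -- The tree cost falls by at least gain plus loss, which exceeds `α * loss` by the acceptance
      -- test.
      · have h3 : (cost c (𝒞.mtst (A ∪ 𝒞.loss K)) : ℝ) + cost c (𝒞.loss K) ≤
            cost c (𝒞.mtst (A ∪ edges (𝒞.comp K))) + cost c (edges (𝒞.comp K)) := by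
          exact_mod_cast 𝒞.cost_mtst_union_loss_le hK A
        unfold gain drop at hgain
        rw [List.map_cons, List.sum_cons]
        push_cast at h1 ⊢
        rw [mul_add]
        linarith
      · rcases List.mem_cons.1 hK' with rfl | hK'
        · have h3 := 𝒞.savings_add_loss_le h hK (A := A ∪ 𝒞.loss K' ∪
            (𝒞.accepted α (A ∪ 𝒞.loss K') Ks).toFinset.biUnion 𝒞.loss)
            (Finset.subset_union_right.trans Finset.subset_union_left)
          have := mul_nonneg hα hpos
          linarith
        · exact h2 K' hK'
    · obtain ⟨h1, h2⟩ := ih hKs' A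
      refine ⟨h1, fun K' hK' => ?_⟩
      rcases List.mem_cons.1 hK' with rfl | hK'
      -- The failed test bounds the savings at the moment of rejection, and later contractions only
      -- lower them.
      · refine (savings_anti Finset.subset_union_left).trans
          ((𝒞.savings_le_drop h hR hK A).trans ?_)
        unfold gain at hgain
        linarith
      · exact h2 K' hK'

lemma savings_empty_le (h : Resolves c W w) (hG : IsMetricInstance G c) {K : Finset V}
    (hK : IsSpannedHyperedge G R K) :
    savings W w G c R ∅ K ≤ 2 * cost c (edges (𝒞.comp K)) := by
  obtain ⟨rfl, htri⟩ := hG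
  obtain ⟨F, h1, h2, h3⟩ := exists_connecting_le_two_mul htri (𝒞.conn_edges_comp hK)
  have h4 := h.savings_le_cost (G := ⊤) (R := R) (A := ∅) (K := K) (F := F)
    (fun e he => ⟨by simpa [SimpleGraph.edgeSet_top] using (h1 e he).1,
      fun v hv => ⟨v, hK.subset ((h1 e he).2 v hv), Conn.refl _ _⟩⟩)
    (fun u hu v hv => by rw [Finset.empty_union]; exact h2 u hu v hv)
  exact h4.trans (by exact_mod_cast h3)

/-- The cost of the output is at most `√3` times the value of any fractional solution that uses
spanned hyperedges only. -/
lemma cost_output_le_sum (hG : IsMetricInstance G c) (hR : R.Nonempty) {order : List (Finset V)}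
    (horder : ∀ K, K ∈ order ↔ IsSpannedHyperedge G R K) {x : Finset V → ℝ≥0}
    (hx : FeasibleP R x) (hx' : ∀ K ∈ hyperedges R, x K ≠ 0 → IsSpannedHyperedge G R K) :
    (cost c (𝒞.output (√3) order) : ℝ) ≤
      √3 * ∑ K ∈ hyperedges R, (x K : ℝ) * cost c (edges (𝒞.comp K)) := by
  obtain ⟨W, w, h⟩ := exists_resolves c
  have h3 : (√3 : ℝ) * √3 = 3 := Real.mul_self_sqrt (by norm_num)
  have h30 : (0 : ℝ) ≤ √3 := Real.sqrt_nonneg 3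
  have h31 : (1 : ℝ) ≤ √3 := Real.one_le_sqrt.2 (by norm_num)
  obtain ⟨h1, h2⟩ := 𝒞.accepted_spec h hR h30 order (fun K hK => (horder K).1 hK) ∅
  rw [Finset.empty_union] at h1 h2
  change _ + (cost c (𝒞.mtst (𝒞.contracted (√3) order)) : ℝ) ≤ _ at h1
  change ∀ K ∈ order, savings W w G c R (𝒞.contracted (√3) order) K ≤ _ at h2
  set S := ∑ K ∈ hyperedges R, (x K : ℝ) * cost c (edges (𝒞.comp K)) with hS
  -- The factor is `1 + (√3 - 1) / 2`, because the loss is at most half of the component.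
  have hfinal : (cost c (𝒞.mtst (𝒞.contracted (√3) order)) : ℝ) ≤ (√3 + 1) / 2 * S := by
    refine (h.cost_mtst_le_sum (𝒞.mtst_spec _) hR hx).trans ?_
    rw [hS, Finset.mul_sum]
    refine Finset.sum_le_sum fun K hK => ?_
    by_cases hxK : x K = 0
    · simp [hxK]
    have hKs := hx' K hK hxK
    have hle := h2 K ((horder K).2 hKs)
    have hloss : 2 * (cost c (𝒞.loss K) : ℝ) ≤ cost c (edges (𝒞.comp K)) := by
      exact_mod_cast (𝒞.loss_spec K hKs).two_mul_cost_le (𝒞.comp_full K hKs).1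
        (𝒞.comp_degree K hKs)
    have hx0 : (0 : ℝ) ≤ x K := NNReal.coe_nonneg _
    have : savings W w G c R (𝒞.contracted (√3) order) K ≤
        (√3 + 1) / 2 * cost c (edges (𝒞.comp K)) := by
      nlinarith
    nlinarith
  have hstart : (cost c (𝒞.mtst ∅) : ℝ) ≤ 2 * S := by
    refine (h.cost_mtst_le_sum (𝒞.mtst_spec _) hR hx).trans ?_
    rw [hS, Finset.mul_sum]
    refine Finset.sum_le_sum fun K hK => ?_
    by_cases hxK : x K = 0
    · simp [hxK]
    have := 𝒞.savings_empty_le h hG (hx' K hK hxK)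
    have hx0 : (0 : ℝ) ≤ x K := NNReal.coe_nonneg _
    nlinarith
  have hout : (cost c (𝒞.output (√3) order) : ℝ) ≤
      cost c (𝒞.mtst (𝒞.contracted (√3) order)) +
        ((𝒞.accepted (√3) ∅ order).map fun K => cost c (𝒞.loss K)).sum := by
    exact_mod_cast cost_union_le.trans
      (add_le_add le_rfl (cost_biUnion_toFinset_le 𝒞.loss (𝒞.accepted (√3) ∅ order)))
  set M := (cost c (𝒞.mtst (𝒞.contracted (√3) order)) : ℝ)
  set L := ((((𝒞.accepted (√3) ∅ order).map fun K => cost c (𝒞.loss K)).sum : ℝ≥0) : ℝ)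
  -- Here `√3 * L ≤ 2 * S - M`, and `(√3 - 1) * (√3 + 1) / 2 = 1`, so the sum is at most `S + 2 *
  -- S`.
  have hkey : √3 * (M + L) ≤ 3 * S := by
    have : (√3 - 1) * M ≤ (√3 - 1) * ((√3 + 1) / 2 * S) :=
      mul_le_mul_of_nonneg_left hfinal (by linarith)
    nlinarith
  have : √3 * (M + L) ≤ √3 * (√3 * S) := by rw [← mul_assoc, h3]; exact hkey
  exact hout.trans (le_of_mul_le_mul_left this (by linarith))

/-! ### The output is a Steiner tree -/

lemma mem_contracted {α : ℝ} {order : List (Finset V)} {e : Sym2 V} :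
    e ∈ 𝒞.contracted α order ↔ ∃ K ∈ 𝒞.accepted α ∅ order, e ∈ 𝒞.loss K := by
  simp [contracted]

/-- If the contracted components share no Steiner vertices, then the contracted edges form a
forest. -/
lemma isForest_contracted {α : ℝ} {order : List (Finset V)}
    (horder : ∀ K ∈ order, IsSpannedHyperedge G R K)
    (hdisj : (𝒞.accepted α ∅ order).Pairwise
      (fun K K' => (𝒞.comp K).verts ∩ (𝒞.comp K').verts ⊆ (R : Set V))) :
    IsForest (𝒞.contracted α order) := by
  have hspan : ∀ K ∈ 𝒞.accepted α ∅ order, IsSpannedHyperedge G R K := fun K hK =>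
    horder K ((𝒞.accepted_sublist α ∅ order).subset hK)
  have hdisj' : ∀ K ∈ 𝒞.accepted α ∅ order, ∀ K' ∈ 𝒞.accepted α ∅ order, K ≠ K' →
      (𝒞.comp K).verts ∩ (𝒞.comp K').verts ⊆ (R : Set V) := by
    intro K hK K' hK' hne
    have : Std.Symm fun K K' => (𝒞.comp K).verts ∩ (𝒞.comp K').verts ⊆ (R : Set V) :=
      ⟨fun _ _ h => by rwa [Set.inter_comm]⟩
    exact List.Pairwise.forall (R := fun K K' => (𝒞.comp K).verts ∩ (𝒞.comp K').verts ⊆ (R : Set V))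
      hdisj hK hK' hne
  -- If `u` is cut off from the terminals within its loss, a path from `u` that avoids the edge
  -- meets only Steiner vertices of this component and cannot pass to another loss. It would close a
  -- cycle in the component.
  have key : ∀ K ∈ 𝒞.accepted α ∅ order, ∀ u v, s(u, v) ∈ 𝒞.loss K →
      (¬ ∃ r ∈ R, Conn ((𝒞.loss K).erase s(u, v)) u r) →
      ¬ Conn ((𝒞.contracted α order).erase s(u, v)) u v := by
    intro K hK u v huv hno hcon
    have hLE := (𝒞.loss_spec K (hspan K hK)).1.1
    have huH := mem_verts_of_mem_edges (hLE huv) (Sym2.mem_mk_left _ _)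
    refine (isTree_coe_iff.1 (𝒞.comp_full K (hspan K hK)).1).2.2 u v (hLE huv) ?_
    refine Conn.mono (Finset.erase_subset_erase _ hLE) ?_
    refine hcon.induction (Conn.refl _ _) fun a b hab ha => ?_
    obtain ⟨hne, hab⟩ := Finset.mem_erase.1 hab
    obtain ⟨K', hK', habK'⟩ := 𝒞.mem_contracted.1 hab
    by_cases hKK' : K = K'
    · subst hKK'
      exact ha.trans (Conn.of_mem (Finset.mem_erase.2 ⟨hne, habK'⟩))
    · exfalso
      have ha1 : a ∈ (𝒞.comp K).verts :=
        (ha.mono ((Finset.erase_subset _ _).trans hLE)).mem_verts huH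
      have ha2 : a ∈ (𝒞.comp K').verts := mem_verts_of_mem_edges
        ((𝒞.loss_spec K' (hspan K' hK')).1.1 habK') (Sym2.mem_mk_left _ _)
      exact hno ⟨a, hdisj' K hK K' hK' hKK' ⟨ha1, ha2⟩, ha⟩
  intro u v huv
  obtain ⟨K, hK, huvK⟩ := 𝒞.mem_contracted.1 huv
  by_cases hu : ∃ r ∈ R, Conn ((𝒞.loss K).erase s(u, v)) u r
  · by_cases hv : ∃ r ∈ R, Conn ((𝒞.loss K).erase s(u, v)) v r
    · obtain ⟨r, hr, hur⟩ := hu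
      obtain ⟨s, hs, hvs⟩ := hv
      -- If both ends still reach terminals, these coincide because a loss joins no two terminals,
      -- and again the component would contain a cycle.
      have hsub := Finset.erase_subset s(u, v) (𝒞.loss K)
      have hrs : r = s := (𝒞.loss_spec K (hspan K hK)).2.2 r hr s hs
        ((hur.mono hsub).symm.trans ((Conn.of_mem huvK).trans (hvs.mono hsub)))
      subst hrs
      have hLE := (𝒞.loss_spec K (hspan K hK)).1.1
      exact absurd ((hur.trans hvs.symm).mono (Finset.erase_subset_erase _ hLE))
        ((isTree_coe_iff.1 (𝒞.comp_full K (hspan K hK)).1).2.2 u v (hLE huvK))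
    · intro hcon
      have := key K hK v u (by rwa [Sym2.eq_swap]) (by rwa [Sym2.eq_swap])
      rw [Sym2.eq_swap] at this
      exact this hcon.symm
  · exact key K hK u v huvK hu

omit [Fintype V] in
-- A cycle through an edge of the forest `A` uses some edge `f` of `T`. The ends of `f` are then
-- connected without it, against minimality of `T`.
lemma _root_.SteinerLP.IsTST.isForest_union {A T : Finset (Sym2 V)} (hT : IsTST G R A T)
    (hA : IsForest A) : IsForest (T ∪ A) := by
  intro u v huv hcon
  by_cases huvT : s(u, v) ∈ T
  · refine hT.not_conn_erase huvT (hcon.mono fun e he => ?_)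
    simp only [Finset.mem_erase, Finset.mem_union] at he ⊢
    tauto
  have huvA : s(u, v) ∈ A := (Finset.mem_union.1 huv).resolve_left huvT
  have hcon' : Conn (A.erase s(u, v) ∪ T) u v := hcon.mono fun e he => by
    simp only [Finset.mem_erase, Finset.mem_union] at he ⊢
    tauto
  obtain ⟨F, hFT, f, hfT, hfF, -, h1, h2⟩ := exists_connecting_edge (hA u v huvA) hcon'
  have hsub : A.erase s(u, v) ∪ F ⊆ A ∪ T.erase f := by
    refine Finset.union_subset_union (Finset.erase_subset _ _) fun e he =>
      Finset.mem_erase.2 ⟨?_, hFT he⟩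
    rintro rfl
    exact hfF he
  have huv' : Conn (A ∪ T.erase f) u v := Conn.of_mem (Finset.mem_union_left _ huvA)
  induction f using Sym2.ind with | _ x y
  refine hT.not_conn_erase hfT ?_
  rcases conn_insert h2 with h | ⟨h3, h4⟩ | ⟨h3, h4⟩
  · exact absurd h h1
  · exact (h3.mono hsub).symm.trans (huv'.trans (h4.mono hsub).symm)
  · exact (h4.mono hsub).trans (huv'.symm.trans (h3.mono hsub))

/-- Losses that meet in a shared Steiner vertex may close cycles, so in general only containment is
available. -/
theorem exists_steinerTree_output (hR : R.Nonempty) {α : ℝ} {order : List (Finset V)}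
    (horder : ∀ K ∈ order, IsSpannedHyperedge G R K) :
    ∃ S : G.Subgraph, IsSteinerTree G R S ∧ edges S ⊆ 𝒞.output α order ∧
      ((𝒞.accepted α ∅ order).Pairwise
        (fun K K' => (𝒞.comp K).verts ∩ (𝒞.comp K').verts ⊆ (R : Set V)) →
          edges S = 𝒞.output α order) := by
  have hspan : ∀ K ∈ 𝒞.accepted α ∅ order, IsSpannedHyperedge G R K := fun K hK =>
    horder K ((𝒞.accepted_sublist α ∅ order).subset hK)
  have hT := (𝒞.mtst_spec (𝒞.contracted α order)).1
  have hlossE : ∀ e ∈ 𝒞.contracted α order, ∃ K ∈ 𝒞.accepted α ∅ order,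
      e ∈ 𝒞.loss K ∧ e ∈ edges (𝒞.comp K) := by
    intro e he
    obtain ⟨K, hK, heK⟩ := 𝒞.mem_contracted.1 he
    exact ⟨K, hK, heK, (𝒞.loss_spec K (hspan K hK)).1.1 heK⟩
  have hE : ∀ e ∈ 𝒞.output α order, e ∈ G.edgeSet := by
    intro e he
    rcases Finset.mem_union.1 he with he | he
    · exact (hT.1.1 e he).1
    · obtain ⟨K, -, -, he'⟩ := hlossE e he
      exact edges_subset he'
  have hconn : ∀ u ∈ R, ∀ v ∈ R, Conn (𝒞.output α order) u v := by
    intro u hu v hv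
    rw [output, Finset.union_comm]
    exact hT.1.conn hu hv
  by_cases hdisj : (𝒞.accepted α ∅ order).Pairwise
      (fun K K' => (𝒞.comp K).verts ∩ (𝒞.comp K').verts ⊆ (R : Set V))
  · have hfor : IsForest (𝒞.output α order) :=
      hT.isForest_union (𝒞.isForest_contracted horder hdisj)
    obtain ⟨S, hS, hSE⟩ := exists_steinerTree_of_isForest hE hR hconn hfor (by
      intro e he
      induction e using Sym2.ind with | _ x y
      refine ⟨x, Sym2.mem_mk_left _ _, ?_⟩
      rcases Finset.mem_union.1 he with he | he
      · exact ((hT.1.1 _ he).2 x (Sym2.mem_mk_left _ _)).mono Finset.subset_union_right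
      · obtain ⟨K, hK, -, he'⟩ := hlossE _ he
        refine (𝒞.inTerminalNode_loss (hspan K hK)
          (mem_verts_of_mem_edges he' (Sym2.mem_mk_left _ _))).mono fun e' he'' => ?_
        exact Finset.mem_union_right _ (𝒞.mem_contracted.2 ⟨K, hK, he''⟩))
    exact ⟨S, hS, hSE.le, fun _ => hSE⟩
  · obtain ⟨S, hS, hSE⟩ := exists_steinerTree hE hR hconn
    exact ⟨S, hS, hSE, fun h => absurd h hdisj⟩

end Choices

/-! ### Integrality gaps -/

section Gap

variable {V : Type*} [Fintype V] [DecidableEq V] {G : SimpleGraph V} {c : Sym2 V → ℝ≥0}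
  {R : Finset V}

omit [DecidableEq V] in
lemma isSpannedHyperedge_of_objective_ne_top {x : Finset V → ℝ≥0} (h : objective G c R x ≠ ⊤)
    {K : Finset V} (hK : K ∈ hyperedges R) (hxK : x K ≠ 0) : IsSpannedHyperedge G R K := by
  refine ⟨hK, ?_⟩
  by_contra hno
  have h1 := (ENNReal.sum_ne_top.1 h) K hK
  have h2 : hyperCost G c R K = ⊤ := by
    unfold hyperCost
    simp only [iInf_eq_top]
    exact fun H hH => absurd ⟨H, hH⟩ hno
  rw [h2] at h1
  exact h1 (ENNReal.mul_top (by exact_mod_cast hxK))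

lemma le_sqrt_three_mul_iInf {ι : Sort*} {p : ι → Prop} {f : ι → ℝ≥0∞} {a : ℝ≥0∞}
    (h : ∀ i, p i → a ≤ ENNReal.ofReal (√3) * f i) :
    a ≤ ENNReal.ofReal (√3) * ⨅ (i) (_ : p i), f i := by
  have h0 : ENNReal.ofReal (√3) ≠ 0 := by
    rw [Ne, ENNReal.ofReal_eq_zero, not_le]
    positivity
  rw [ENNReal.mul_iInf_of_ne h0 ENNReal.ofReal_ne_top]
  refine le_iInf fun i => ?_
  rw [ENNReal.mul_iInf_of_ne h0 ENNReal.ofReal_ne_top]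
  exact le_iInf (h i)

theorem Choices.cost_output_le (𝒞 : Choices G c R) (hG : IsMetricInstance G c) (hR : R.Nonempty)
    {order : List (Finset V)} (horder : ∀ K, K ∈ order ↔ IsSpannedHyperedge G R K) :
    (cost c (𝒞.output (√3) order) : ℝ≥0∞) ≤ ENNReal.ofReal (√3) * optP G c R := by
  refine le_sqrt_three_mul_iInf fun x hx => ?_
  by_cases htop : objective G c R x = ⊤
  · rw [htop, ENNReal.mul_top]
    · exact le_top
    · rw [Ne, ENNReal.ofReal_eq_zero, not_le]
      positivity
  have h1 := 𝒞.cost_output_le_sum hG hR horder hx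
    fun K hK hxK => isSpannedHyperedge_of_objective_ne_top htop hK hxK
  have h2 : ((∑ K ∈ hyperedges R, x K * cost c (edges (𝒞.comp K)) : ℝ≥0) : ℝ≥0∞) ≤
      objective G c R x := by
    unfold objective
    push_cast
    refine Finset.sum_le_sum fun K hK => ?_
    by_cases hxK : x K = 0
    · simp [hxK]
    · gcongr
      exact le_iInf₂ fun H hH => by
        exact_mod_cast 𝒞.comp_min K (isSpannedHyperedge_of_objective_ne_top htop hK hxK) H hH
  refine le_trans ?_ (mul_le_mul_right h2 _)
  rw [ENNReal.ofReal, ← ENNReal.coe_mul, ENNReal.coe_le_coe, ← NNReal.coe_le_coe]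
  push_cast
  rwa [Real.coe_toNNReal _ (Real.sqrt_nonneg 3)]

lemma steinerOpt_le_of_isMetricInstance (hG : IsMetricInstance G c) (hR : R.Nonempty) :
    steinerOpt G c R ≤ ENNReal.ofReal (√3) * optP G c R := by
  classical
  obtain ⟨𝒞⟩ := nonempty_choices (R := R) hG
  set order := (Finset.univ.filter fun K => IsSpannedHyperedge G R K).toList with hord
  have horder : ∀ K, K ∈ order ↔ IsSpannedHyperedge G R K := by simp [hord]
  obtain ⟨S, hS, hSE, -⟩ := 𝒞.exists_steinerTree_output hR (α := √3) (order := order)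
    fun K hK => (horder K).1 hK
  refine ((iInf₂_le S hS).trans ?_).trans (𝒞.cost_output_le hG hR horder)
  exact_mod_cast cost_mono hSE

/-! ### Reduction to metric instances -/

/-- The set of all edges of `G`. -/
noncomputable def allEdges (G : SimpleGraph V) : Finset (Sym2 V) := (Set.toFinite G.edgeSet).toFinset

omit [DecidableEq V] in
lemma mem_allEdges {e : Sym2 V} : e ∈ allEdges G ↔ e ∈ G.edgeSet := by simp [allEdges]

/-- The metric closure: the cost of a pair is the minimum cost of edges of `G` that connect it, and
the cost of all edges if there are none. -/
lemma exists_metric_closure (G : SimpleGraph V) (c : Sym2 V → ℝ≥0) : ∃ c' : Sym2 V → ℝ≥0,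
    (∀ e, ∃ F ⊆ allEdges G, (F = allEdges G ∨ ∀ u ∈ e, ∀ v ∈ e, Conn F u v) ∧ cost c F = c' e) ∧
    ∀ e, ∀ F ⊆ allEdges G, (F = allEdges G ∨ ∀ u ∈ e, ∀ v ∈ e, Conn F u v) → c' e ≤ cost c F := by
  classical
  have : ∀ e : Sym2 V, ∃ F ∈ (allEdges G).powerset.filter fun F =>
      F = allEdges G ∨ ∀ u ∈ e, ∀ v ∈ e, Conn F u v, ∀ F' ∈ (allEdges G).powerset.filter fun F =>
      F = allEdges G ∨ ∀ u ∈ e, ∀ v ∈ e, Conn F u v, cost c F ≤ cost c F' := fun e =>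
    Finset.exists_min_image _ _ ⟨allEdges G, by simp⟩
  choose F hF hmin using this
  refine ⟨fun e => cost c (F e), fun e => ?_, fun e F' hF' h => ?_⟩
  · have := Finset.mem_filter.1 (hF e)
    exact ⟨F e, Finset.mem_powerset.1 this.1, this.2, rfl⟩
  · exact hmin e F' (Finset.mem_filter.2 ⟨Finset.mem_powerset.2 hF', h⟩)

omit [Fintype V] [DecidableEq V] in
lemma forall_conn_mk {F : Finset (Sym2 V)} {u v : V} :
    (∀ a ∈ s(u, v), ∀ b ∈ s(u, v), Conn F a b) ↔ Conn F u v := by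
  refine ⟨fun h => h u (Sym2.mem_mk_left _ _) v (Sym2.mem_mk_right _ _), fun h a ha b hb => ?_⟩
  rcases Sym2.mem_iff.1 ha with rfl | rfl <;> rcases Sym2.mem_iff.1 hb with rfl | rfl
  exacts [Conn.refl _ _, h, h.symm, Conn.refl _ _]

/-- A full component of `G` remains one in the complete graph, with the same vertices and edges. -/
lemma hyperCost_top_le {c' : Sym2 V → ℝ≥0} (hc : ∀ e ∈ G.edgeSet, c' e ≤ c e) (K : Finset V) :
    hyperCost ⊤ c' R K ≤ hyperCost G c R K := by
  refine le_iInf₂ fun H hH => ?_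
  have hsub : ∀ e ∈ edges H, e ∈ (⊤ : SimpleGraph V).edgeSet ∧ ∀ v ∈ e, v ∈ H.verts :=
    fun e he => ⟨SimpleGraph.edgeSet_mono le_top (edges_subset he),
      fun v hv => mem_verts_of_mem_edges he hv⟩
  have hN : ∀ v, (subgraphOf ⊤ H.verts (edges H) hsub).neighborSet v = H.neighborSet v := by
    intro v
    ext w
    exact mk_mem_edges
  refine (iInf₂_le (subgraphOf ⊤ H.verts (edges H) hsub) ⟨?_, hH.2.1, fun v hv => ?_⟩).trans ?_
  · rw [edges_subgraphOf]
    exact_mod_cast Finset.sum_le_sum fun e he => hc e (edges_subset he)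
  · rw [isTree_coe_iff, edges_subgraphOf]
    exact isTree_coe_iff.1 hH.1
  · rw [hN]
    exact hH.2.2 v hv

/-- A spanned hyperedge lies in one component of `G` and contributes nothing to the constraint for
the partition of `R` by these components. So there is only one part. -/
lemma conn_allEdges_of_objective_ne_top {x : Finset V → ℝ≥0} (hx : FeasibleP R x)
    (h : objective G c R x ≠ ⊤) : ∀ u ∈ R, ∀ v ∈ R, Conn (allEdges G) u v := by
  obtain ⟨π, h1, h2⟩ := exists_finpartition (allEdges G) R
  have hle : (π.parts.card : ℝ) - 1 ≤ 0 := by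
    refine (hx π).trans (Finset.sum_nonpos fun K hK => ?_)
    by_cases hxK : x K = 0
    · simp [hxK]
    obtain ⟨-, H, hH⟩ := isSpannedHyperedge_of_objective_ne_top h hK hxK
    refine mul_nonpos_of_nonneg_of_nonpos (NNReal.coe_nonneg _) ?_
    rw [rankContribution, h2 K (Finset.mem_powerset.1 (Finset.mem_filter.1 hK).1), sub_nonpos]
    have : numClasses (allEdges G) K ≤ 1 := by
      have hKH : ∀ u ∈ K, u ∈ H.verts := fun u hu => by
        have : u ∈ H.verts ∩ (R : Set V) := by rw [hH.2.1]; exact hu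
        exact this.1
      exact numClasses_le_one fun u hu v hv =>
        ((isTree_coe_iff.1 hH.1).2.1 u (hKH u hu) v (hKH v hv)).mono
          fun e he => mem_allEdges.2 (edges_subset he)
    exact_mod_cast this
  intro u hu v hv
  by_contra huv
  have h3 := two_le_numClasses huv
  have h4 := numClasses_mono (E := allEdges G) (X := {u, v}) (Y := R)
    (by simp [Finset.insert_subset_iff, hu, hv])
  rw [h1, sub_nonpos] at hle
  have : numClasses (allEdges G) R ≤ 1 := by exact_mod_cast hle
  omega

theorem steinerOpt_le_optP (hR : R.Nonempty) :
    steinerOpt G c R ≤ ENNReal.ofReal (√3) * optP G c R := by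
  obtain ⟨c', hc1, hc2⟩ := exists_metric_closure G c
  have hmetric : IsMetricInstance (⊤ : SimpleGraph V) c' := by
    refine ⟨rfl, fun u v w _ _ _ => ?_⟩
    obtain ⟨F₁, hF₁, h₁, e₁⟩ := hc1 s(u, v)
    obtain ⟨F₂, hF₂, h₂, e₂⟩ := hc1 s(v, w)
    rw [← e₁, ← e₂]
    have hsub := Finset.union_subset hF₁ hF₂
    refine (hc2 _ (F₁ ∪ F₂) hsub ?_).trans cost_union_le
    rw [forall_conn_mk] at h₁ h₂ ⊢
    -- If one of the two values comes from the set of all edges, then so does the union; the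
    -- fallback keeps the closure metric even when `G` is disconnected.
    rcases h₁ with rfl | h₁
    · exact Or.inl (subset_antisymm hsub Finset.subset_union_left)
    rcases h₂ with rfl | h₂
    · exact Or.inl (subset_antisymm hsub Finset.subset_union_right)
    exact Or.inr ((h₁.mono Finset.subset_union_left).trans (h₂.mono Finset.subset_union_right))
  refine le_sqrt_three_mul_iInf fun x hx => ?_
  by_cases htop : objective G c R x = ⊤
  · rw [htop, ENNReal.mul_top]
    · exact le_top
    · rw [Ne, ENNReal.ofReal_eq_zero, not_le]
      positivity
  have hconn := conn_allEdges_of_objective_ne_top hx htop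
  have h1 : steinerOpt G c R ≤ steinerOpt ⊤ c' R := by
    refine le_iInf₂ fun S hS => ?_
    choose F hFG hF hcost using hc1
    refine (steinerOpt_le (E := (edges S).biUnion F) (fun e he => ?_) hR fun u hu v hv => ?_).trans ?_
    · obtain ⟨e', -, he'⟩ := Finset.mem_biUnion.1 he
      exact mem_allEdges.1 (hFG e' he')
    · by_cases hall : ∃ e ∈ edges S, F e = allEdges G
      · obtain ⟨e, he, heF⟩ := hall
        exact (hconn u hu v hv).mono (heF ▸ Finset.subset_biUnion_of_mem F he)
      · push Not at hall
        refine ((isTree_coe_iff.1 hS.1).2.1 u (hS.2 hu) v (hS.2 hv)).of_edges fun a b hab => ?_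
        exact (forall_conn_mk.1 ((hF s(a, b)).resolve_left (hall _ hab))).mono
          (Finset.subset_biUnion_of_mem F hab)
    · rw [ENNReal.coe_le_coe]
      calc cost c ((edges S).biUnion F) ≤ ∑ e ∈ edges S, cost c (F e) := cost_biUnion_le _ _
        _ = cost c' (edges S) := Finset.sum_congr rfl fun e _ => hcost e
  have h2 : objective ⊤ c' R x ≤ objective G c R x := by
    unfold objective
    gcongr with K
    refine hyperCost_top_le (fun e he => ?_) K
    have := hc2 e {e} (by simpa using mem_allEdges.2 he) (Or.inr ?_)
    · simpa [cost] using this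
    · induction e using Sym2.ind with | _ u v
      exact forall_conn_mk.2 (Conn.of_mem (Finset.mem_singleton_self _))
  calc steinerOpt G c R ≤ steinerOpt ⊤ c' R := h1
    _ ≤ ENNReal.ofReal (√3) * optP ⊤ c' R := steinerOpt_le_of_isMetricInstance hmetric hR
    _ ≤ ENNReal.ofReal (√3) * objective G c R x := by
      gcongr
      exact (iInf₂_le x hx).trans h2

/-! ### Relations between the relaxations -/

lemma optP_le_optP' : optP G c R ≤ optP' G c R :=
  le_iInf₂ fun x hx => iInf₂_le x hx.1

omit [Fintype V] in
lemma sum_card_inter_parts (π : Finpartition R) {K : Finset V} (hK : K ⊆ R) :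
    ∑ p ∈ π.parts, (K ∩ p).card = K.card := by
  rw [← Finset.card_biUnion]
  · congr 1
    rw [← Finset.inter_biUnion]
    refine Finset.inter_eq_left.2 (hK.trans_eq ?_)
    exact π.biUnion_parts.symm
  · intro p hp q hq hpq
    exact (π.disjoint hp hq hpq).mono Finset.inter_subset_right Finset.inter_subset_right

omit [Fintype V] in
-- A part `p` that meets `K` contributes 1 = |K ∩ p| - ρ(K ∩ p); by truncation a part that misses
-- `K` contributes 0.
lemma rankContribution_eq (π : Finpartition R) {K : Finset V} (hK : K ⊆ R) (hne : K.Nonempty) :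
    rankContribution π K = rank K - ∑ p ∈ π.parts, (rank (K ∩ p) : ℝ) := by
  have h1 : (π.parts.filter fun p => (K ∩ p).Nonempty).card + ∑ p ∈ π.parts, rank (K ∩ p) =
      K.card := by
    rw [← sum_card_inter_parts π hK, Finset.card_filter, ← Finset.sum_add_distrib]
    refine Finset.sum_congr rfl fun p _ => ?_
    unfold rank
    split_ifs with h
    · have := h.card_pos; omega
    · rw [Finset.not_nonempty_iff_eq_empty.1 h]; rfl
  have h2 : rank K + 1 = K.card := by have := hne.card_pos; unfold rank; omega
  have h3 : ((π.parts.filter fun p => (K ∩ p).Nonempty).card : ℝ) +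
      ∑ p ∈ π.parts, (rank (K ∩ p) : ℝ) = rank K + 1 := by
    exact_mod_cast h1.trans h2.symm
  rw [rankContribution]
  linarith

omit [Fintype V] in
-- Subtract the constraints for the parts of the partition from the equality for `R`, and apply
-- `rankContribution_eq` to `K` and to `R`.
lemma FeasibleS.feasibleP (hR : R.Nonempty) {x : Finset V → ℝ≥0} (hx : FeasibleS R x) :
    FeasibleP R x := by
  intro π
  have h1 : ∑ K ∈ hyperedges R, (x K : ℝ) * rank K = rank R := by exact_mod_cast hx.1
  have h2 : ∑ K ∈ hyperedges R, (x K : ℝ) * ∑ p ∈ π.parts, (rank (K ∩ p) : ℝ) ≤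
      ∑ p ∈ π.parts, (rank (R ∩ p) : ℝ) := by
    simp_rw [Finset.mul_sum]
    rw [Finset.sum_comm]
    refine Finset.sum_le_sum fun p hp => ?_
    have hpR : p ⊆ R := π.le hp
    rw [Finset.inter_eq_right.2 hpR]
    exact_mod_cast hx.2 p hpR
  have h3 := rankContribution_eq π subset_rfl hR
  have h4 : ∑ K ∈ hyperedges R, (x K : ℝ) * rankContribution π K =
      ∑ K ∈ hyperedges R, (x K : ℝ) * rank K -
        ∑ K ∈ hyperedges R, (x K : ℝ) * ∑ p ∈ π.parts, (rank (K ∩ p) : ℝ) := by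
    rw [← Finset.sum_sub_distrib]
    refine Finset.sum_congr rfl fun K hK => ?_
    rw [rankContribution_eq π (Finset.mem_powerset.1 (Finset.mem_filter.1 hK).1)
      (Finset.mem_filter.1 hK).2, mul_sub]
  have h5 : rankContribution π R = (π.parts.card : ℝ) - 1 := by
    rw [rankContribution, Finset.filter_true_of_mem]
    intro p hp
    rw [Finset.inter_eq_right.2 (π.le hp)]
    exact π.nonempty_of_mem_parts hp
  linarith

lemma optP_le_optS (hR : R.Nonempty) : optP G c R ≤ optS G c R :=
  le_iInf₂ fun x hx => iInf₂_le x (hx.feasibleP hR)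

omit [Fintype V] in
-- Sum the cut constraints over the parts without the root. A hyperedge `K` with head `i` leaves
-- those parts that `K` meets, except the part of `i`, hence at most the rank contribution of `K`
-- many.
lemma FeasibleD.feasibleP {r : V} (hr : r ∈ R) {x : Finset V → V → ℝ≥0} (hx : FeasibleD R r x) :
    FeasibleP R fun K => ∑ i ∈ K, x K i := by
  intro π
  obtain ⟨p₀, hp₀, hrp₀⟩ := π.exists_mem hr
  have h1 : ((π.parts.erase p₀).card : ℝ) ≤ ∑ p ∈ π.parts.erase p₀, ∑ K ∈ hyperedges R,
      ∑ i ∈ K, (if (K ∩ p).Nonempty ∧ i ∉ p then (x K i : ℝ) else 0) := by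
    rw [← nsmul_one, ← Finset.sum_const]
    refine Finset.sum_le_sum fun p hp => ?_
    obtain ⟨hpne, hp⟩ := Finset.mem_erase.1 hp
    have hrp : r ∉ p := fun h =>
      hpne (π.disjoint.elim_finset hp hp₀ r h hrp₀)
    have := hx p (π.le hp) (π.nonempty_of_mem_parts hp) hrp
    rw [← NNReal.coe_le_coe] at this
    push_cast at this
    refine this.trans_eq ?_
    rw [Finset.sum_filter]
    refine Finset.sum_congr rfl fun K _ => ?_
    rw [Finset.inter_comm p K]
    split_ifs with h
    · rw [← Finset.filter_notMem_eq_sdiff, Finset.sum_filter]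
      simp [h]
    · simp [h]
  have h2 : ((π.parts.erase p₀).card : ℝ) = (π.parts.card : ℝ) - 1 := by
    rw [Finset.card_erase_of_mem hp₀, Nat.cast_sub (Finset.card_pos.2 ⟨p₀, hp₀⟩), Nat.cast_one]
  rw [← h2]
  -- The root's part is included again, which can only increase a sum of non-negative terms.
  refine (h1.trans (Finset.sum_le_sum_of_subset_of_nonneg (Finset.erase_subset _ _) ?_)).trans ?_
  · intro p _ _
    refine Finset.sum_nonneg fun K _ => Finset.sum_nonneg fun i _ => ?_
    split_ifs
    exacts [NNReal.coe_nonneg _, le_rfl]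
  rw [Finset.sum_comm]
  refine Finset.sum_le_sum fun K hK => ?_
  rw [Finset.sum_comm]
  push_cast
  rw [Finset.sum_mul]
  refine Finset.sum_le_sum fun i hi => ?_
  have hKR := Finset.mem_powerset.1 (Finset.mem_filter.1 hK).1
  obtain ⟨q, hq, hiq⟩ := π.exists_mem (hKR hi)
  rw [← Finset.sum_filter, Finset.sum_const, nsmul_eq_mul, mul_comm]
  gcongr
  have hsub : (π.parts.filter fun p => (K ∩ p).Nonempty ∧ i ∉ p) ⊆
      (π.parts.filter fun p => (K ∩ p).Nonempty).erase q := by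
    intro p hp
    simp only [Finset.mem_filter, Finset.mem_erase] at hp ⊢
    exact ⟨fun h => hp.2.2 (h ▸ hiq), hp.1, hp.2.1⟩
  have hqmem : q ∈ π.parts.filter fun p => (K ∩ p).Nonempty :=
    Finset.mem_filter.2 ⟨hq, i, Finset.mem_inter.2 ⟨hi, hiq⟩⟩
  have h3 := Finset.card_le_card hsub
  have h4 := Finset.card_erase_add_one hqmem
  rw [rankContribution, le_sub_iff_add_le]
  exact_mod_cast (by omega : (π.parts.filter fun p => (K ∩ p).Nonempty ∧ i ∉ p).card + 1 ≤
    (π.parts.filter fun p => (K ∩ p).Nonempty).card)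

lemma optP_le_optD {r : V} (hr : r ∈ R) : optP G c R ≤ optD G c R r := by
  refine le_iInf₂ fun x hx => (iInf₂_le _ (hx.feasibleP hr)).trans_eq ?_
  unfold objective
  refine Finset.sum_congr rfl fun K _ => ?_
  push_cast
  rw [Finset.sum_mul]

end Gap

end SteinerLP

theorem mainTheorem9 {V : Type*} [Fintype V] [DecidableEq V] (G : SimpleGraph V)
    (c : Sym2 V → ℝ≥0) (R : Finset V) (hR : R.Nonempty) :
    -- On complete metric instances the heuristic can be run, and for all choices that it makes and
    -- all orders in which it examines the full components, its output contains a Steiner tree, is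
    -- itself one if the contracted components share no Steiner vertices, and costs at most √3 OPT(P).
    (SteinerLP.IsMetricInstance G c →
      Nonempty (SteinerLP.Choices G c R) ∧
      ∀ (𝒞 : SteinerLP.Choices G c R) (order : List (Finset V)), order.Nodup →
        (∀ K, K ∈ order ↔ SteinerLP.IsSpannedHyperedge G R K) →
        (∃ S : G.Subgraph, SteinerLP.IsSteinerTree G R S ∧
          SteinerLP.edges S ⊆ 𝒞.output (√3) order ∧
          ((𝒞.accepted (√3) ∅ order).Pairwise
              (fun K K' => (𝒞.comp K).verts ∩ (𝒞.comp K').verts ⊆ (R : Set V)) →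
            SteinerLP.edges S = 𝒞.output (√3) order)) ∧
        (SteinerLP.cost c (𝒞.output (√3) order) : ℝ≥0∞) ≤
          ENNReal.ofReal (√3) * SteinerLP.optP G c R) ∧
    -- The integrality gap of each hypergraphic relaxation is at most √3, on all instances.
    SteinerLP.steinerOpt G c R ≤ ENNReal.ofReal (√3) * SteinerLP.optP G c R ∧
    SteinerLP.steinerOpt G c R ≤ ENNReal.ofReal (√3) * SteinerLP.optP' G c R ∧
    SteinerLP.steinerOpt G c R ≤ ENNReal.ofReal (√3) * SteinerLP.optS G c R ∧
    ∀ r ∈ R, SteinerLP.steinerOpt G c R ≤ ENNReal.ofReal (√3) * SteinerLP.optD G c R r := by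
  refine ⟨fun hG => ⟨SteinerLP.nonempty_choices hG, fun 𝒞 order _ horder =>
    ⟨𝒞.exists_steinerTree_output hR fun K hK => (horder K).1 hK,
      𝒞.cost_output_le hG hR horder⟩⟩, SteinerLP.steinerOpt_le_optP hR, ?_, ?_, fun r hr => ?_⟩
  · exact (SteinerLP.steinerOpt_le_optP hR).trans (by gcongr; exact SteinerLP.optP_le_optP')
  · exact (SteinerLP.steinerOpt_le_optP hR).trans (by gcongr; exact SteinerLP.optP_le_optS hR)
  · exact (SteinerLP.steinerOpt_le_optP hR).trans (by gcongr; exact SteinerLP.optP_le_optD hr)
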